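/- Let $\mathbb{T}=\mathbb{R}\cup\{-\infty\}$ with $x\oplus y=\max\{x,y\}$ and $x\odot y=x+y$. A tropical (Laurent) polynomial in $n$ variables is a formal expression $f=\bigoplus_{\mathbf{i}\in\mathbb{Z}^n}c_{\mathbf{i}}\mathbf{x}^{\mathbf{i}}$ with $c_{\mathbf{i}}\in\mathbb{T}$, only finitely many $c_{\mathbf{i}}$ being different from $-\infty$; sums and products of such polynomials are formed in the natural way. It defines the function $f(t)=\max_{\mathbf{i}}(c_{\mathbf{i}}+\mathbf{i}\cdot t)$ on $\mathbb{R}^n$, and its Newton polytope $\mathrm{Newt}(f)\subset\mathbb{R}^n$ is the convex hull of $\{\mathbf{i}\mid c_{\mathbf{i}}\neq-\infty\}$. An expression of a function $\varphi:\mathbb{R}^n\to\mathbb{T}$ is a pair $(f,g)$ of tropical polynomials with $g\neq-\infty$ and $\varphi=f\oslash g$, that is, $\varphi(t)=f(t)-g(t)$ for all $t\in\mathbb{R}^n$. The volume $\mathrm{vol}(f,g)$ is the $(n+1)$-dimensional volume of $\mathrm{Newt}(f\oplus(x_{n+1}\odot g))\subset\mathbb{R}^{n+1}$ (it is $0$ if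 this polytope is not full-dimensional). A minimum volume expression of $\varphi$ is an expression whose volume is at most that of every other expression of $\varphi$. Consider the tropical polynomials in two variables \begin{align*} f_1&=xy\oplus(-1)y^2\oplus x\oplus y\oplus 0, & g_1&=(-1)xy^2\oplus xy\oplus(-1)y^2\oplus x\oplus y,\\ f_2&=x^2\oplus xy\oplus(-1)y^2\oplus x\oplus(-1)y, & g_2&=(-1)x^2y\oplus(-1)xy^2\oplus x^2\oplus xy\oplus(-1)y^2 . \end{align*} Then $f_1\oslash g_1=f_2\oslash g_2$ as functions on $\mathbb{R}^2$. This tropical rational function $\varphi$ has exactly two different minimum volume expressions, up to multiplying numerator and denominator by a common monomial $c\,x^iy^j$ ($c\in\mathbb{R}$, $i,j\in\mathbb{Z}$), namely $(f_1,g_1)$ and $(f_2,g_2)$: 1. $(f_1,g_1)$ and $(f_2,g_2)$ are minimum volume expressions of $\varphi$, and $\mathrm{vol}(f_1,g_1)=\mathrm{vol}(f_2,g_2)=5/3$. 2. They are different: $(f_2,g_2)$ does not arise from $(f_1,g_1)$ by multiplying both entries by a common monomial, and the polytopes $\mathrm{Newt}(f_1\oplus(z\odot g_1))$ and $\mathrm{Newt}(f_2\oplus(z\odot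 g_2))$ in $\mathbb{R}^3$ are not translates of each other. 3. A pair $(f,g)$ of tropical polynomials is a minimum volume expression of $\varphi$ if and only if $(f,g)=(m\odot f_1,m\odot g_1)$ or $(f,g)=(m\odot f_2,m\odot g_2)$ for some monomial $m=c\,x^iy^j$ with $c\in\mathbb{R}$, $i,j\in\mathbb{Z}$. 4. Every expression $(f,g)$ of $\varphi$ that is not of the form in 3 satisfies $\mathrm{vol}(f,g)\geq 11/6$. -/

import Mathlib

/-- A tropical Laurent polynomial in `n` variables over the max-plus algebra
`𝕋 = ℝ ∪ {-∞} = WithBot ℝ`: a family of coefficients indexed by `ℤⁿ`, only finitely many of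
which differ from `-∞ = ⊥`. It is a formal expression, not a function. -/
@[ext]
structure TropPoly (n : ℕ) where
  coeff : (Fin n → ℤ) → WithBot ℝ
  finite_support : {i | coeff i ≠ ⊥}.Finite

namespace TropPoly

variable {n : ℕ}

/-- The exponents whose coefficient is not `-∞`. -/
noncomputable def support (f : TropPoly n) : Finset (Fin n → ℤ) :=
  f.finite_support.toFinset

/-- The tropical polynomial `-∞`. -/
instance : Bot (TropPoly n) :=
  ⟨⟨fun _ => ⊥, by simp⟩⟩

/-- The tropical sum: the coefficientwise maximum. -/
instance : Add (TropPoly n) :=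
  ⟨fun f g => ⟨fun i => max (f.coeff i) (g.coeff i), by
    refine (f.finite_support.union g.finite_support).subset fun i hi => ?_
    by_contra h
    simp only [Set.mem_union, Set.mem_ofPred_eq, not_or, not_not] at h
    exact hi (by simp [h.1, h.2])⟩⟩

/-- The tropical product: the `i`-th coefficient is `max_{j + k = i} (f_j + g_k)`. -/
noncomputable instance : Mul (TropPoly n) :=
  ⟨fun f g => ⟨fun i => f.support.sup fun j => f.coeff j + g.coeff (i - j), by
    refine (f.finite_support.add g.finite_support).subset fun i hi => ?_
    by_contra h
    refine hi ((Finset.sup_eq_bot_iff _ _).2 fun j hj => ?_)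
    have hj' : f.coeff j ≠ ⊥ := by simpa [support] using hj
    by_contra hne
    exact h ⟨j, hj', i - j, fun h0 => hne (by simp [h0]), by simp⟩⟩⟩

/-- The monomial `c x^k` with real coefficient `c`. -/
noncomputable def monomial (c : ℝ) (k : Fin n → ℤ) : TropPoly n :=
  ⟨fun i => if i = k then (c : WithBot ℝ) else ⊥, by
    refine (Set.finite_singleton k).subset fun i hi => ?_
    by_contra h
    exact hi (if_neg h)⟩

/-- The variable `x_k`. -/
noncomputable def X (k : Fin n) : TropPoly n :=
  monomial 0 (Pi.single k 1)

/-- The function `ℝⁿ → ℝ ∪ {-∞}` defined by a tropical polynomial: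
`f(t) = max_i (c_i + i₁ t₁ + ⋯ + iₙ tₙ)`. -/
noncomputable def eval (f : TropPoly n) (t : Fin n → ℝ) : WithBot ℝ :=
  f.support.sup fun i => f.coeff i + ((∑ k, (i k : ℝ) * t k : ℝ) : WithBot ℝ)

/-- The function `f ⊘ g`, `t ↦ f(t) - g(t)`. It is meaningful for `g ≠ -∞`, in which case
`g(t)` is a real number for every `t`. -/
noncomputable def quot (f g : TropPoly n) (t : Fin n → ℝ) : WithBot ℝ :=
  (f.eval t).map fun a => a - (g.eval t).unbotD 0

/-- The Newton polytope: the convex hull of the exponents whose coefficient is not `-∞`. -/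
def newt (f : TropPoly n) : Set (Fin n → ℝ) :=
  convexHull ℝ ((fun (i : Fin n → ℤ) k => (i k : ℝ)) '' {i | f.coeff i ≠ ⊥})

/-- A polynomial in `x₁, …, xₙ` regarded as a polynomial in `x₁, …, xₙ₊₁`. -/
def lift (f : TropPoly n) : TropPoly (n + 1) :=
  ⟨fun j => if j (Fin.last n) = 0 then f.coeff (fun k => j k.castSucc) else ⊥, by
    refine (f.finite_support.image
      fun i => (Fin.snoc i 0 : Fin (n + 1) → ℤ)).subset fun j hj => ?_
    have h0 : j (Fin.last n) = 0 := by
      by_contra h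
      exact hj (if_neg h)
    refine ⟨fun k => j k.castSucc, fun h => hj (by simp [h]), ?_⟩
    funext k
    refine Fin.lastCases ?_ (fun k => ?_) k <;> simp [h0]⟩

/-- The polynomial `f ⊕ (xₙ₊₁ ⊙ g)` in `n + 1` variables. -/
noncomputable def graphPoly (f g : TropPoly n) : TropPoly (n + 1) :=
  f.lift + X (Fin.last n) * g.lift

/-- The volume of the pair `(f, g)`: the `(n+1)`-dimensional Lebesgue measure of
`Newt(f ⊕ (xₙ₊₁ ⊙ g))`, which is `0` if the polytope is not full-dimensional. -/
noncomputable def vol (f g : TropPoly n) : ℝ :=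
  (MeasureTheory.volume (graphPoly f g).newt).toReal

/-- `φ = f ⊘ g` is an expression of the function `φ` by tropical polynomials `f` and
`g ≠ -∞`. -/
def IsExpression (φ : (Fin n → ℝ) → WithBot ℝ) (f g : TropPoly n) : Prop :=
  g ≠ ⊥ ∧ φ = quot f g

/-- `φ = f ⊘ g` is an expression of minimum volume. -/
def IsMinVolExpression (φ : (Fin n → ℝ) → WithBot ℝ) (f g : TropPoly n) : Prop :=
  IsExpression φ f g ∧ ∀ f' g' : TropPoly n, IsExpression φ f' g' → vol f g ≤ vol f' g'

/-- The pair `(f', g')` arises from `(f, g)` by multiplying both by one common monomial,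
that is, by a unit. -/
def SameUpToMonomial (f g f' g' : TropPoly n) : Prop :=
  ∃ (c : ℝ) (k : Fin n → ℤ), f' = monomial c k * f ∧ g' = monomial c k * g

/-- `f₁ = xy ⊕ (-1)y² ⊕ x ⊕ y ⊕ 0`. -/
noncomputable def f₁ : TropPoly 2 :=
  monomial 0 ![1, 1] + monomial (-1) ![0, 2] + monomial 0 ![1, 0] + monomial 0 ![0, 1] +
    monomial 0 ![0, 0]

/-- `g₁ = (-1)xy² ⊕ xy ⊕ (-1)y² ⊕ x ⊕ y`. -/
noncomputable def g₁ : TropPoly 2 :=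
  monomial (-1) ![1, 2] + monomial 0 ![1, 1] + monomial (-1) ![0, 2] + monomial 0 ![1, 0] +
    monomial 0 ![0, 1]

/-- `f₂ = x² ⊕ xy ⊕ (-1)y² ⊕ x ⊕ (-1)y`. -/
noncomputable def f₂ : TropPoly 2 :=
  monomial 0 ![2, 0] + monomial 0 ![1, 1] + monomial (-1) ![0, 2] + monomial 0 ![1, 0] +
    monomial (-1) ![0, 1]

/-- `g₂ = (-1)x²y ⊕ (-1)xy² ⊕ x² ⊕ xy ⊕ (-1)y²`. -/
noncomputable def g₂ : TropPoly 2 :=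
  monomial (-1) ![2, 1] + monomial (-1) ![1, 2] + monomial 0 ![2, 0] + monomial 0 ![1, 1] +
    monomial (-1) ![0, 2]

end TropPoly

/-! The function has the closed form `phi`, which stays within bounded distance of the positively
homogeneous `phiRec`. The latter is linear except for breaks along the six rays ±(1,0), ±(0,1),
±(1,1). If (f, g) expresses `phi`, then in a generic direction the leading exponents of f and g
differ by the gradient of `phiRec` there. Comparing the two sides of each ray
(`Expresses.exists_shape`) shows that the edge of Newt(f) is one lattice unit longer than that of
Newt(g) in the directions (-1,0), (0,-1), (1,1), and one unit shorter in the opposite directions.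

Hence, for each of the functionals x, y, x + y, a unit segment on a long edge of f and one on the
opposite long edge of g span an octahedron inside the three-dimensional polytope. Its volume is 2/3
of the width of the polygon. A volume below 2 therefore forces all three widths to be at most 2, and
only a few shapes remain (`Expresses.small_cases`).

Width 1 in y is impossible (`Expresses.not_two_rows`): f and g would have degree one in y with
coefficients continuous in x, while the root in y of the numerator jumps from 0 to 1 at x = 0. Two
shapes contain regions of total volume 7/3. The other two are the supports of the given pairs, up to
the midpoint of one edge of each polynomial. For them the coefficients are read off along lines on
which f and g have degree one after division by a monomial: the lines y = const for the first shape,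
y = x + const for the second. There `linear_quot_unique` separates numerator from denominator, and
`solve_first` and `solve_second` determine all coefficients up to a common constant.

The value 5/3 is 2 - 1/3, the volume of the region `slab` of height 2. This is the first polytope,
and an affine map of determinant -1 carries it to the second. -/

namespace TropPoly

/-! ### Tropical polynomials: real values, products with monomials, the polytope of a pair -/

section Basic

variable {n : ℕ}

theorem mem_support {f : TropPoly n} {i : Fin n → ℤ} : i ∈ f.support ↔ f.coeff i ≠ ⊥ := by
  simp [support]

theorem coeff_bot (i : Fin n → ℤ) : (⊥ : TropPoly n).coeff i = ⊥ := rfl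

theorem coeff_add (f g : TropPoly n) (i : Fin n → ℤ) :
    (f + g).coeff i = max (f.coeff i) (g.coeff i) := rfl

theorem coeff_monomial (c : ℝ) (k i : Fin n → ℤ) :
    (monomial c k).coeff i = if i = k then (c : WithBot ℝ) else ⊥ := rfl

theorem coeff_monomial_mul (c : ℝ) (k : Fin n → ℤ) (f : TropPoly n) (i : Fin n → ℤ) :
    (monomial c k * f).coeff i = (c : WithBot ℝ) + f.coeff (i - k) := by
  have hs : (monomial c k).support = {k} := by
    ext j
    simp [mem_support, coeff_monomial]
  change (monomial c k).support.sup (fun j => (monomial c k).coeff j + f.coeff (i - j)) = _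
  rw [hs, Finset.sup_singleton, coeff_monomial, if_pos rfl]

theorem coeff_monomial_mul_ne_bot (c : ℝ) (k : Fin n → ℤ) (f : TropPoly n) (i : Fin n → ℤ) :
    (monomial c k * f).coeff i ≠ ⊥ ↔ f.coeff (i - k) ≠ ⊥ := by
  rw [coeff_monomial_mul]
  simp [WithBot.add_eq_bot]

theorem support_nonempty {f : TropPoly n} (hf : f ≠ ⊥) : f.support.Nonempty := by
  by_contra h
  rw [Finset.not_nonempty_iff_eq_empty] at h
  refine hf (TropPoly.ext (funext fun i => ?_))
  by_contra hi
  have : i ∈ f.support := mem_support.2 hi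
  simp [h] at this

/-- The real coefficient at `i`, with value `0` where the coefficient is `-∞`. -/
noncomputable def realCoeff (f : TropPoly n) (i : Fin n → ℤ) : ℝ := (f.coeff i).unbotD 0

theorem coe_realCoeff {f : TropPoly n} {i : Fin n → ℤ} (hi : f.coeff i ≠ ⊥) :
    ((f.realCoeff i : ℝ) : WithBot ℝ) = f.coeff i := by
  unfold realCoeff
  obtain ⟨c, hc⟩ := WithBot.ne_bot_iff_exists.1 hi
  rw [← hc]; rfl

/-- The pairing of an exponent with a point. -/
noncomputable def pair (i : Fin n → ℤ) (t : Fin n → ℝ) : ℝ := ∑ k, (i k : ℝ) * t k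

/-- The value of a tropical polynomial at a point as a real number. -/
noncomputable def evalReal (f : TropPoly n) (t : Fin n → ℝ) : ℝ := (f.eval t).unbotD 0

theorem exists_eval_eq {f : TropPoly n} (hf : f ≠ ⊥) (t : Fin n → ℝ) :
    ∃ i, f.coeff i ≠ ⊥ ∧ f.eval t = ((f.realCoeff i + pair i t : ℝ) : WithBot ℝ) := by
  obtain ⟨i, hi, h⟩ := Finset.exists_mem_eq_sup f.support (support_nonempty hf)
    fun i => f.coeff i + ((∑ k, (i k : ℝ) * t k : ℝ) : WithBot ℝ)
  have hi' := mem_support.1 hi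
  refine ⟨i, hi', ?_⟩
  rw [WithBot.coe_add, coe_realCoeff hi']
  exact h

theorem coe_evalReal {f : TropPoly n} (hf : f ≠ ⊥) (t : Fin n → ℝ) :
    ((f.evalReal t : ℝ) : WithBot ℝ) = f.eval t := by
  obtain ⟨i, -, h⟩ := exists_eval_eq hf t
  rw [evalReal, h]
  rfl

theorem exists_evalReal_eq {f : TropPoly n} (hf : f ≠ ⊥) (t : Fin n → ℝ) :
    ∃ i, f.coeff i ≠ ⊥ ∧ f.evalReal t = f.realCoeff i + pair i t := by
  obtain ⟨i, hi, h⟩ := exists_eval_eq hf t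
  exact ⟨i, hi, by rw [← coe_evalReal hf, WithBot.coe_inj] at h; exact h⟩

theorem le_evalReal {f : TropPoly n} {i : Fin n → ℤ} (hi : f.coeff i ≠ ⊥) (t : Fin n → ℝ) :
    f.realCoeff i + pair i t ≤ f.evalReal t := by
  have hf : f ≠ ⊥ := by
    rintro rfl
    exact hi rfl
  rw [← WithBot.coe_le_coe, coe_evalReal hf, WithBot.coe_add, coe_realCoeff hi]
  exact Finset.le_sup (f := fun i => f.coeff i + ((∑ k, (i k : ℝ) * t k : ℝ) : WithBot ℝ))
    (mem_support.2 hi)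

theorem evalReal_eq_of_le {f : TropPoly n} {t : Fin n → ℝ} {a : ℝ}
    (h1 : ∃ i, f.coeff i ≠ ⊥ ∧ a ≤ f.realCoeff i + pair i t)
    (h2 : ∀ i, f.coeff i ≠ ⊥ → f.realCoeff i + pair i t ≤ a) : f.evalReal t = a := by
  obtain ⟨i, hi, h⟩ := h1
  have hf : f ≠ ⊥ := by
    rintro rfl
    exact hi rfl
  refine le_antisymm ?_ (h.trans (le_evalReal hi t))
  obtain ⟨j, hj, e⟩ := exists_evalReal_eq hf t
  exact e ▸ h2 j hj

theorem eval_bot (t : Fin n → ℝ) : (⊥ : TropPoly n).eval t = ⊥ := by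
  have : (⊥ : TropPoly n).support = ∅ := by
    ext i; simp [mem_support, coeff_bot]
  simp [eval, this]

theorem monomial_mul_ne_bot {f : TropPoly n} (hf : f ≠ ⊥) (c : ℝ) (k : Fin n → ℤ) :
    monomial c k * f ≠ ⊥ := by
  obtain ⟨i, hi⟩ := support_nonempty hf
  intro h
  have := (coeff_monomial_mul_ne_bot c k f (i + k)).2 (by simpa using mem_support.1 hi)
  exact this (by rw [h]; rfl)

theorem realCoeff_monomial_mul (c : ℝ) (k : Fin n → ℤ) (f : TropPoly n) {i : Fin n → ℤ}
    (hi : f.coeff (i - k) ≠ ⊥) :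
    (monomial c k * f).realCoeff i = c + f.realCoeff (i - k) := by
  rw [← WithBot.coe_inj, coe_realCoeff ((coeff_monomial_mul_ne_bot c k f i).2 hi),
    coeff_monomial_mul, WithBot.coe_add, coe_realCoeff hi]

theorem pair_sub (i k : Fin n → ℤ) (t : Fin n → ℝ) : pair (i - k) t = pair i t - pair k t := by
  simp [pair, sub_mul, Finset.sum_sub_distrib]

theorem evalReal_monomial_mul (c : ℝ) (k : Fin n → ℤ) {f : TropPoly n} (hf : f ≠ ⊥)
    (t : Fin n → ℝ) : (monomial c k * f).evalReal t = c + pair k t + f.evalReal t := by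
  refine evalReal_eq_of_le ?_ fun i hi => ?_
  · obtain ⟨i, hi, e⟩ := exists_evalReal_eq hf t
    have hi' : f.coeff (i + k - k) ≠ ⊥ := by simpa using hi
    refine ⟨i + k, (coeff_monomial_mul_ne_bot c k f _).2 hi', ?_⟩
    rw [realCoeff_monomial_mul c k f hi', e]
    have := pair_sub (i + k) k t
    rw [add_sub_cancel_right] at this ⊢
    linarith
  · rw [coeff_monomial_mul_ne_bot] at hi
    rw [realCoeff_monomial_mul c k f hi]
    have := le_evalReal hi t
    rw [pair_sub] at this
    linarith

theorem quot_eq {f g : TropPoly n} (hf : f ≠ ⊥) (t : Fin n → ℝ) :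
    quot f g t = ((f.evalReal t - g.evalReal t : ℝ) : WithBot ℝ) := by
  rw [quot, ← coe_evalReal hf]
  rfl

/-- Two pairs express the same function exactly if the differences of values agree. -/
theorem isExpression_quot_iff {f g p q : TropPoly n} (hp : p ≠ ⊥) :
    IsExpression (quot p q) f g ↔ f ≠ ⊥ ∧ g ≠ ⊥ ∧
      ∀ t, f.evalReal t - g.evalReal t = p.evalReal t - q.evalReal t := by
  constructor
  · rintro ⟨hg, h⟩
    -- If f were -∞, the quotient would be -∞ everywhere, but the given function is finite because p
    -- is not -∞.
    have hf : f ≠ ⊥ := by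
      rintro rfl
      have := congrFun h 0
      rw [quot_eq hp, quot, eval_bot] at this
      exact WithBot.coe_ne_bot this
    refine ⟨hf, hg, fun t => ?_⟩
    have := congrFun h t
    rw [quot_eq hp, quot_eq hf, WithBot.coe_inj] at this
    exact this.symm
  · rintro ⟨hf, hg, h⟩
    refine ⟨hg, funext fun t => ?_⟩
    rw [quot_eq hp, quot_eq hf, h]

theorem evalReal_add {f g : TropPoly n} (hf : f ≠ ⊥) (hg : g ≠ ⊥) (t : Fin n → ℝ) :
    (f + g).evalReal t = max (f.evalReal t) (g.evalReal t) := by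
  have key : ∀ i, (f + g).coeff i ≠ ⊥ → (f + g).realCoeff i + pair i t ≤
      max (f.evalReal t) (g.evalReal t) := by
    intro i hi
    rcases le_total (f.coeff i) (g.coeff i) with h | h
    · have e : (f + g).coeff i = g.coeff i := by rw [coeff_add, max_eq_right h]
      rw [realCoeff, e]
      exact le_max_of_le_right (le_evalReal (e ▸ hi) t)
    · have e : (f + g).coeff i = f.coeff i := by rw [coeff_add, max_eq_left h]
      rw [realCoeff, e]
      exact le_max_of_le_left (le_evalReal (e ▸ hi) t)
  have low : ∀ i (p : TropPoly n), p.coeff i ≠ ⊥ → p.coeff i ≤ (f + g).coeff i →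
      (f + g).coeff i ≠ ⊥ ∧ p.realCoeff i + pair i t ≤ (f + g).realCoeff i + pair i t := by
    intro i p hi h
    have h' : (f + g).coeff i ≠ ⊥ := fun e => hi (le_bot_iff.1 (e ▸ h))
    refine ⟨h', ?_⟩
    rw [← coe_realCoeff hi, ← coe_realCoeff h', WithBot.coe_le_coe] at h
    linarith
  refine evalReal_eq_of_le ?_ key
  rcases le_total (f.evalReal t) (g.evalReal t) with h | h
  · rw [max_eq_right h]
    obtain ⟨i, hi, e⟩ := exists_evalReal_eq hg t
    obtain ⟨h1, h2⟩ := low i g hi (le_max_right _ _)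
    exact ⟨i, h1, e ▸ h2⟩
  · rw [max_eq_left h]
    obtain ⟨i, hi, e⟩ := exists_evalReal_eq hf t
    obtain ⟨h1, h2⟩ := low i f hi (le_max_left _ _)
    exact ⟨i, h1, e ▸ h2⟩

theorem monomial_ne_bot (c : ℝ) (k : Fin n → ℤ) : monomial c k ≠ ⊥ := by
  intro h
  have := congrArg (fun p => p.coeff k) h
  simp [coeff_monomial, coeff_bot] at this

theorem add_ne_bot {f g : TropPoly n} (hf : f ≠ ⊥) : f + g ≠ ⊥ := by
  obtain ⟨i, hi⟩ := support_nonempty hf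
  intro h
  have : (f + g).coeff i = ⊥ := by rw [h]; rfl
  rw [coeff_add] at this
  exact mem_support.1 hi (le_bot_iff.1 (this ▸ le_max_left _ _))

theorem evalReal_monomial (c : ℝ) (k : Fin n → ℤ) (t : Fin n → ℝ) :
    (monomial c k).evalReal t = c + pair k t := by
  have hk : (monomial c k).coeff k = c := by simp [coeff_monomial]
  refine evalReal_eq_of_le ⟨k, by simp [hk], by simp [realCoeff, hk]⟩ fun i hi => ?_
  have : i = k := by
    by_contra h
    exact hi (by simp [coeff_monomial, h])
  subst this
  simp [realCoeff, hk]

/-- The support of `f ⊕ (xₙ₊₁ ⊙ g)`. -/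
theorem coeff_graphPoly_ne_bot (f g : TropPoly n) (j : Fin (n + 1) → ℤ) :
    (graphPoly f g).coeff j ≠ ⊥ ↔
      (j (Fin.last n) = 0 ∧ f.coeff (fun k => j k.castSucc) ≠ ⊥) ∨
      (j (Fin.last n) = 1 ∧ g.coeff (fun k => j k.castSucc) ≠ ⊥) := by
  have h1 : (graphPoly f g).coeff j = max (f.lift.coeff j)
      ((X (Fin.last n) * g.lift).coeff j) := rfl
  have h2 : (X (Fin.last n) * g.lift).coeff j ≠ ⊥ ↔
      g.lift.coeff (j - Pi.single (Fin.last n) 1) ≠ ⊥ :=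
    coeff_monomial_mul_ne_bot _ _ _ _
  have h3 : (graphPoly f g).coeff j ≠ ⊥ ↔
      f.lift.coeff j ≠ ⊥ ∨ (X (Fin.last n) * g.lift).coeff j ≠ ⊥ := by
    rw [h1, ← not_iff_not]
    simp
  have h4 : ∀ (p : TropPoly n) (i : Fin (n + 1) → ℤ), p.lift.coeff i ≠ ⊥ ↔
      i (Fin.last n) = 0 ∧ p.coeff (fun k => i k.castSucc) ≠ ⊥ := by
    intro p i
    change (if i (Fin.last n) = 0 then p.coeff (fun k => i k.castSucc) else ⊥) ≠ ⊥ ↔ _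
    split_ifs with h <;> simp [h]
  have h5 : (fun k : Fin n => (j - Pi.single (Fin.last n) 1 : Fin (n + 1) → ℤ) k.castSucc) =
      fun k => j k.castSucc := by
    funext k
    simp [(Fin.castSucc_lt_last k).ne]
  rw [h3, h2, h4, h4, h5]
  simp [sub_eq_zero]

theorem convex_newt (f : TropPoly n) : Convex ℝ f.newt := convex_convexHull ℝ _

theorem volume_newt_ne_top (f : TropPoly n) : MeasureTheory.volume f.newt ≠ ⊤ :=
  ((f.finite_support.image _).isCompact_convexHull ℝ).measure_lt_top.ne

/-- The volume of a pair does not change under multiplication by a common monomial. -/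
theorem vol_monomial_mul (c : ℝ) (k : Fin n → ℤ) (f g : TropPoly n) :
    vol (monomial c k * f) (monomial c k * g) = vol f g := by
  set v : Fin (n + 1) → ℤ := Fin.snoc k 0 with hv
  have hc : ∀ (p : TropPoly n) (j : Fin (n + 1) → ℤ),
      (monomial c k * p).coeff (fun l => j l.castSucc) ≠ ⊥ ↔
        p.coeff (fun l => (j - v) l.castSucc) ≠ ⊥ := by
    intro p j
    rw [coeff_monomial_mul_ne_bot]
    have : (fun l : Fin n => j l.castSucc) - k = fun l => (j - v) l.castSucc := by
      funext l
      simp [hv]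
    rw [this]
  have hs : ∀ j, (graphPoly (monomial c k * f) (monomial c k * g)).coeff j ≠ ⊥ ↔
      (graphPoly f g).coeff (j - v) ≠ ⊥ := by
    intro j
    rw [coeff_graphPoly_ne_bot, coeff_graphPoly_ne_bot, hc, hc]
    simp [hv]
  set w : Fin (n + 1) → ℝ := fun l => (v l : ℝ) with hw
  have hn : (graphPoly (monomial c k * f) (monomial c k * g)).newt =
      (AffineMap.id ℝ (Fin (n + 1) → ℝ) + AffineMap.const ℝ (Fin (n + 1) → ℝ) w) '' (graphPoly f g).newt := by
    unfold newt
    rw [AffineMap.image_convexHull]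
    congr 1
    ext p
    constructor
    · rintro ⟨j, hj, rfl⟩
      refine ⟨_, ⟨j - v, (hs j).1 hj, rfl⟩, ?_⟩
      funext l
      simp [hw]
    · rintro ⟨_, ⟨j, hj, rfl⟩, rfl⟩
      refine ⟨j + v, (hs _).2 (by simpa using hj), ?_⟩
      funext l
      simp [hw]
  unfold vol
  rw [hn]
  congr 1
  have : ⇑(AffineMap.id ℝ (Fin (n + 1) → ℝ) + AffineMap.const ℝ (Fin (n + 1) → ℝ) w) = fun p => p + w := by
    funext p
    simp
  rw [this, Set.image_add_right, MeasureTheory.measure_preimage_add_right]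

end Basic

/-! ### Polytopes of pairs in two variables -/

section Planar

theorem lower_mem_newt {f g : TropPoly 2} {a b : ℤ} (h : f.coeff ![a, b] ≠ ⊥) :
    (![(a : ℝ), b, 0] : Fin 3 → ℝ) ∈ (graphPoly f g).newt := by
  refine subset_convexHull ℝ _ ⟨![a, b, 0], ?_, ?_⟩
  · refine (coeff_graphPoly_ne_bot f g _).2 (Or.inl ⟨rfl, ?_⟩)
    convert h using 2
    funext k
    fin_cases k <;> rfl
  · funext k
    fin_cases k <;> simp

theorem upper_mem_newt {f g : TropPoly 2} {a b : ℤ} (h : g.coeff ![a, b] ≠ ⊥) :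
    (![(a : ℝ), b, 1] : Fin 3 → ℝ) ∈ (graphPoly f g).newt := by
  refine subset_convexHull ℝ _ ⟨![a, b, 1], ?_, ?_⟩
  · refine (coeff_graphPoly_ne_bot f g _).2 (Or.inr ⟨rfl, ?_⟩)
    convert h using 2
    funext k
    fin_cases k <;> rfl
  · funext k
    fin_cases k <;> simp

theorem newt_graphPoly_subset {f g : TropPoly 2} {K : Set (Fin 3 → ℝ)} (hK : Convex ℝ K)
    (hf : ∀ a b : ℤ, f.coeff ![a, b] ≠ ⊥ → (![(a : ℝ), b, 0] : Fin 3 → ℝ) ∈ K)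
    (hg : ∀ a b : ℤ, g.coeff ![a, b] ≠ ⊥ → (![(a : ℝ), b, 1] : Fin 3 → ℝ) ∈ K) :
    (graphPoly f g).newt ⊆ K := by
  refine convexHull_min ?_ hK
  rintro _ ⟨j, hj, rfl⟩
  have e : (fun k : Fin 2 => j k.castSucc) = ![j 0, j 1] := by
    funext k
    fin_cases k <;> rfl
  rcases (coeff_graphPoly_ne_bot f g j).1 hj with ⟨h0, h⟩ | ⟨h0, h⟩
  all_goals
    rw [e] at h
    have h0' : j 2 = _ := h0
  · convert hf _ _ h using 1
    funext k
    fin_cases k <;> simp [h0']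
  · convert hg _ _ h using 1
    funext k
    fin_cases k <;> simp [h0']

end Planar

end TropPoly

namespace TropPoly

open MeasureTheory Set

/-! ### Volume of the region `slab` and of its affine images -/

section Volume

theorem integral_abs_sub {x : ℝ} (h0 : 0 ≤ x) (h1 : x ≤ 1) :
    ∫ z in (0 : ℝ)..1, |z - x| = (x ^ 2 + (1 - x) ^ 2) / 2 := by
  have hint : ∀ a b : ℝ, IntervalIntegrable (fun z => |z - x|) volume a b := fun a b =>
    (by fun_prop : Continuous fun z : ℝ => |z - x|).intervalIntegrable a b
  rw [← intervalIntegral.integral_add_adjacent_intervals (hint 0 x) (hint x 1)]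
  have e1 : ∫ z in (0 : ℝ)..x, |z - x| = ∫ z in (0 : ℝ)..x, (x - z) := by
    refine intervalIntegral.integral_congr fun z hz => ?_
    rw [uIcc_of_le h0] at hz
    rw [abs_of_nonpos (by linarith [hz.2])]
    ring
  have e2 : ∫ z in x..1, |z - x| = ∫ z in x..1, (z - x) := by
    refine intervalIntegral.integral_congr fun z hz => ?_
    rw [uIcc_of_le h1] at hz
    rw [abs_of_nonneg (by linarith [hz.1])]
  rw [e1, e2, intervalIntegral.integral_sub, intervalIntegral.integral_sub]
  · simp
    ring
  all_goals exact Continuous.intervalIntegrable (by fun_prop) _ _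

/-- The integrand is the length of the fibre of `slab` over (x, z) in the direction of y. -/
theorem integral_sub_abs (h : ℝ) :
    ∫ x in (0 : ℝ)..1, ∫ z in (0 : ℝ)..1, (h - |z - x|) = h - 1 / 3 := by
  have : ∫ x in (0 : ℝ)..1, ∫ z in (0 : ℝ)..1, (h - |z - x|) =
      ∫ x in (0 : ℝ)..1, (h - (x ^ 2 + (1 - x) ^ 2) / 2) := by
    refine intervalIntegral.integral_congr fun x hx => ?_
    rw [uIcc_of_le zero_le_one] at hx
    rw [intervalIntegral.integral_sub, integral_abs_sub hx.1 hx.2]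
    · simp
    all_goals exact Continuous.intervalIntegrable (by fun_prop) _ _
  rw [this]
  have hd : ∀ x ∈ uIcc (0 : ℝ) 1, HasDerivAt
      (fun x : ℝ => h * x - (x ^ 3 / 3 - (1 - x) ^ 3 / 3) / 2)
      (h - (x ^ 2 + (1 - x) ^ 2) / 2) x := by
    intro x _
    have h1 := (hasDerivAt_id x).const_mul h
    have h2 := ((hasDerivAt_id x).pow 3).div_const 3
    have h3 := (((hasDerivAt_id x).const_sub 1).pow 3).div_const 3
    refine (h1.sub ((h2.sub h3).div_const 2)).congr_deriv ?_
    simp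
    ring
  rw [intervalIntegral.integral_eq_sub_of_hasDerivAt hd
    (Continuous.intervalIntegrable (by fun_prop) _ _)]
  norm_num
  ring

/-- The convex region `0 ≤ z ≤ 1`, `(z - x)⁺ ≤ y ≤ h - (x - z)⁺` over `x ∈ I`. -/
def slab (I : Set ℝ) (h : ℝ) : Set (Fin 3 → ℝ) :=
  {p | p 0 ∈ I ∧ p 2 ∈ Icc (0 : ℝ) 1 ∧ max 0 (p 2 - p 0) ≤ p 1 ∧
    p 1 ≤ h + min 0 (p 2 - p 0)}

theorem measurableSet_slab {I : Set ℝ} (hI : MeasurableSet I) (h : ℝ) :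
    MeasurableSet (slab I h) := by
  refine ((measurable_pi_apply 0) hI).inter (((measurable_pi_apply 2) measurableSet_Icc).inter
    (MeasurableSet.inter ?_ ?_))
  · exact measurableSet_le (f := fun p : Fin 3 → ℝ => max 0 (p 2 - p 0)) (by fun_prop)
      (by fun_prop)
  · exact measurableSet_le (g := fun p : Fin 3 → ℝ => h + min 0 (p 2 - p 0)) (by fun_prop)
      (by fun_prop)

/-- Fubini with the y-fibres, whose length h - |z - x| is nonnegative as h ≥ 1. Since `I` matters
only up to null sets, closed and open intervals are covered together; the open ones give disjoint
pieces later. -/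
theorem volume_slab {I : Set ℝ} (hI : MeasurableSet I) (hI' : I ⊆ Icc 0 1)
    (hae : I =ᵐ[volume] Ioc (0 : ℝ) 1) {h : ℝ} (hh : 1 ≤ h) :
    volume (slab I h) = ENNReal.ofReal (h - 1 / 3) := by
  have hp1 := (volume_preserving_piFinSuccAbove (fun _ : Fin 3 => ℝ) 1)
  have hp2 := (volume_preserving_finTwoArrow ℝ)
  have hp := (MeasurePreserving.prod (MeasurePreserving.id (volume : Measure ℝ)) hp2).comp hp1
  set S : Set (ℝ × ℝ × ℝ) := {q | q.2 ∈ I ×ˢ Icc (0 : ℝ) 1 ∧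
    q.1 ∈ Icc (max 0 (q.2.2 - q.2.1)) (h + min 0 (q.2.2 - q.2.1))} with hS
  have hSm : MeasurableSet S := by
    refine (measurable_snd (hI.prod measurableSet_Icc)).inter (MeasurableSet.inter ?_ ?_)
    · exact measurableSet_le (f := fun q : ℝ × ℝ × ℝ => max 0 (q.2.2 - q.2.1)) (by fun_prop)
        (by fun_prop)
    · exact measurableSet_le (g := fun q : ℝ × ℝ × ℝ => h + min 0 (q.2.2 - q.2.1))
        (by fun_prop) (by fun_prop)
  have e1 : volume (slab I h) = volume S := by
    rw [Measure.volume_eq_prod, ← hp.measure_preimage hSm.nullMeasurableSet]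
    congr 1
    ext p
    have : (Prod.map id MeasurableEquiv.finTwoArrow ∘
        MeasurableEquiv.piFinSuccAbove (fun _ : Fin 3 => ℝ) 1) p = (p 1, p 0, p 2) := rfl
    rw [mem_preimage, this]
    simp only [slab, hS, mem_ofPred_eq, mem_prod, mem_Icc, and_assoc]
  have e2 : ∀ q : ℝ × ℝ, volume ((fun y => (y, q)) ⁻¹' S) =
      (I ×ˢ Icc (0 : ℝ) 1).indicator (fun q => ENNReal.ofReal (h - |q.2 - q.1|)) q := by
    intro q
    by_cases hq : q ∈ I ×ˢ Icc (0 : ℝ) 1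
    · rw [indicator_of_mem hq]
      have : (fun y => (y, q)) ⁻¹' S = Icc (max 0 (q.2 - q.1)) (h + min 0 (q.2 - q.1)) := by
        ext y
        simp only [hS, mem_preimage, mem_ofPred_eq, hq, true_and]
      rw [this, Real.volume_Icc]
      congr 1
      have := max_sub_min_eq_abs' 0 (q.2 - q.1)
      rw [zero_sub, abs_neg] at this
      linarith
    · rw [indicator_of_notMem hq]
      have : (fun y => (y, q)) ⁻¹' S = ∅ := by
        ext y
        simp only [hS, mem_preimage, mem_ofPred_eq, hq, false_and, mem_empty_iff_false]
      rw [this, measure_empty]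
  rw [e1, Measure.volume_eq_prod, Measure.prod_apply_symm hSm]
  simp_rw [e2]
  rw [lintegral_indicator (hI.prod measurableSet_Icc)]
  have hcont : Continuous fun q : ℝ × ℝ => h - |q.2 - q.1| := by fun_prop
  have hintK : IntegrableOn (fun q : ℝ × ℝ => h - |q.2 - q.1|) (Icc 0 1 ×ˢ Icc 0 1) :=
    hcont.continuousOn.integrableOn_compact (isCompact_Icc.prod isCompact_Icc)
  have hint : IntegrableOn (fun q : ℝ × ℝ => h - |q.2 - q.1|) (I ×ˢ Icc 0 1) :=
    hintK.mono_set (prod_mono hI' le_rfl)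
  rw [← ofReal_integral_eq_lintegral_ofReal hint]
  · congr 1
    rw [Measure.volume_eq_prod, setIntegral_prod _ hint, ← integral_sub_abs h,
      setIntegral_congr_set hae, intervalIntegral.integral_of_le zero_le_one]
    congr 1
    funext x
    rw [intervalIntegral.integral_of_le zero_le_one, integral_Icc_eq_integral_Ioc]
  · refine (ae_restrict_iff' (hI.prod measurableSet_Icc)).2 (Filter.Eventually.of_forall ?_)
    rintro ⟨x, z⟩ ⟨hx, hz⟩
    have hx := hI' hx
    simp only [mem_Icc] at hx hz
    have : |z - x| ≤ 1 := abs_le.2 ⟨by linarith, by linarith⟩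
    simp only [Pi.zero_apply]
    linarith

theorem volume_slab_Icc {h : ℝ} (hh : 1 ≤ h) :
    volume (slab (Icc 0 1) h) = ENNReal.ofReal (h - 1 / 3) :=
  volume_slab measurableSet_Icc le_rfl Ioc_ae_eq_Icc.symm hh

theorem volume_slab_Ioo {h : ℝ} (hh : 1 ≤ h) :
    volume (slab (Ioo 0 1) h) = ENNReal.ofReal (h - 1 / 3) :=
  volume_slab measurableSet_Ioo Ioo_subset_Icc_self Ioo_ae_eq_Ioc hh

theorem convex_slab (h : ℝ) : Convex ℝ (slab (Icc 0 1) h) := by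
  have : slab (Icc 0 1) h = {p : Fin 3 → ℝ | 0 ≤ p 0} ∩ {p | p 0 ≤ 1} ∩ {p | 0 ≤ p 2} ∩
      {p | p 2 ≤ 1} ∩ {p | 0 ≤ p 1} ∩ {p | p 2 - p 0 ≤ p 1} ∩ {p | p 1 ≤ h} ∩
      {p | p 1 ≤ h + (p 2 - p 0)} := by
    ext p
    simp only [slab, mem_ofPred_eq, mem_inter_iff, mem_Icc, max_le_iff, ← min_add_add_left,
      le_min_iff, add_zero]
    tauto
  rw [this]
  intro p hp q hq a b ha hb hab
  simp only [mem_inter_iff, mem_ofPred_eq, Pi.add_apply, Pi.smul_apply, smul_eq_mul] at *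
  refine ⟨⟨⟨⟨⟨⟨⟨?_, ?_⟩, ?_⟩, ?_⟩, ?_⟩, ?_⟩, ?_⟩, ?_⟩ <;>
  · obtain rfl : b = 1 - a := by linarith
    nlinarith

/-- A convex set that contains the vertices of `slab (Icc 0 1) h` contains the region. -/
theorem slab_subset {K : Set (Fin 3 → ℝ)} (hK : Convex ℝ K) {h : ℝ}
    (h1 : ![0, 0, 0] ∈ K) (h2 : ![0, 1, 1] ∈ K) (h3 : ![1, 0, 1] ∈ K) (h4 : ![1, 0, 0] ∈ K)
    (h5 : ![0, h, 0] ∈ K) (h6 : ![0, h, 1] ∈ K) (h7 : ![1, h, 1] ∈ K)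
    (h8 : ![1, h - 1, 0] ∈ K) : slab (Icc 0 1) h ⊆ K := by
  have tri : ∀ {p q r : Fin 3 → ℝ}, p ∈ K → q ∈ K → r ∈ K → ∀ {a b c : ℝ}, 0 ≤ a → 0 ≤ b →
      0 ≤ c → a + b + c = 1 → a • p + b • q + c • r ∈ K := by
    intro p q r hp hq hr a b c ha hb hc habc
    have := hK.sum_mem (t := Finset.univ) (w := ![a, b, c]) (z := ![p, q, r])
      (by intro i _; fin_cases i <;> simpa) (by simpa [Fin.sum_univ_three] using habc)
      (by intro i _; fin_cases i <;> simpa)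
    simpa [Fin.sum_univ_three] using this
  rintro p ⟨⟨hx0, hx1⟩, ⟨hz0, hz1⟩, hlo, hhi⟩
  set x := p 0
  set y := p 1
  set z := p 2
  -- The lower and the upper boundary surface are each made of two triangles meeting along x = z;
  -- the weights are barycentric coordinates in the triangle on the relevant side.
  have hlow : ![x, max 0 (z - x), z] ∈ K := by
    rcases le_total x z with hxz | hxz
    · convert tri h1 h2 h3 (a := 1 - z) (b := z - x) (c := x) (by linarith) (by linarith)
        (by linarith) (by ring) using 1
      rw [max_eq_right (by linarith)]
      funext k
      fin_cases k <;> simp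
    · convert tri h1 h4 h3 (a := 1 - x) (b := x - z) (c := z) (by linarith) (by linarith)
        (by linarith) (by ring) using 1
      rw [max_eq_left (by linarith)]
      funext k
      fin_cases k <;> simp
  have hupp : ![x, h + min 0 (z - x), z] ∈ K := by
    rcases le_total x z with hxz | hxz
    · convert tri h5 h6 h7 (a := 1 - z) (b := z - x) (c := x) (by linarith) (by linarith)
        (by linarith) (by ring) using 1
      rw [min_eq_left (by linarith)]
      funext k
      fin_cases k <;> (simp; try ring)
    · convert tri h5 h8 h7 (a := 1 - x) (b := x - z) (c := z) (by linarith) (by linarith)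
        (by linarith) (by ring) using 1
      rw [min_eq_right (by linarith)]
      funext k
      fin_cases k <;> (simp; try ring)
  set lo := max 0 (z - x)
  set up := h + min 0 (z - x)
  have hp : p = ![x, y, z] := by
    funext k
    fin_cases k <;> rfl
  rw [hp]
  rcases hlo.eq_or_lt with e | hlt
  · rwa [← e]
  · have hd : 0 < up - lo := by linarith
    obtain ⟨θ, hθ⟩ : ∃ θ, θ * (up - lo) = y - lo := ⟨(y - lo) / (up - lo), by field_simp⟩
    have h0 : 0 ≤ θ := by
      by_contra hneg
      nlinarith
    have h1 : θ ≤ 1 := by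
      by_contra hneg
      nlinarith
    convert hK hlow hupp (a := 1 - θ) (b := θ) (by linarith) h0 (by ring) using 1
    funext k
    fin_cases k
    · simp
      ring
    · simp
      linarith
    · simp
      ring

/-- If a convex set contains the images of the vertices of `slab (Icc 0 1) h` under an affine
map, then it contains the image of the region. -/
theorem image_slab_subset {K : Set (Fin 3 → ℝ)} (hK : Convex ℝ K) {h : ℝ}
    (N : Matrix (Fin 3) (Fin 3) ℝ) (o : Fin 3 → ℝ)
    (h1 : o + N.mulVec ![0, 0, 0] ∈ K) (h2 : o + N.mulVec ![0, 1, 1] ∈ K)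
    (h3 : o + N.mulVec ![1, 0, 1] ∈ K) (h4 : o + N.mulVec ![1, 0, 0] ∈ K)
    (h5 : o + N.mulVec ![0, h, 0] ∈ K) (h6 : o + N.mulVec ![0, h, 1] ∈ K)
    (h7 : o + N.mulVec ![1, h, 1] ∈ K) (h8 : o + N.mulVec ![1, h - 1, 0] ∈ K) :
    (fun p => o + N.mulVec p) '' slab (Icc 0 1) h ⊆ K := by
  rw [image_subset_iff]
  refine slab_subset ?_ h1 h2 h3 h4 h5 h6 h7 h8
  intro p hp q hq a b ha hb hab
  have := hK hp hq ha hb hab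
  simp only [mem_preimage]
  convert this using 1
  rw [Matrix.mulVec_add, Matrix.mulVec_smul, Matrix.mulVec_smul, smul_add, smul_add]
  have : o = a • o + b • o := by rw [← add_smul, hab, one_smul]
  nth_rewrite 1 [this]
  abel

theorem volume_affine_image (N : Matrix (Fin 3) (Fin 3) ℝ) (o : Fin 3 → ℝ)
    (s : Set (Fin 3 → ℝ)) : volume ((fun p => o + N.mulVec p) '' s) =
      ENNReal.ofReal |N.det| * volume s := by
  have : (fun p => o + N.mulVec p) '' s = (fun p => o + p) '' (Matrix.toLin' N '' s) := by
    rw [image_image]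
    rfl
  rw [this, image_add_left, measure_preimage_add, Measure.addHaar_image_linearMap,
    LinearMap.det_toLin']

end Volume

/-- The volume is at least `2 d / 3` if the polytope contains the octahedron spanned by the
triangles `a, a + u, a + v` in the lower and `a + u + c, a + v + c, a + u + v + c` in the upper
level, where `d` is the determinant of `u` and `v`. -/
theorem le_vol_of_octahedron {f g : TropPoly 2} (a₀ a₁ u₀ u₁ v₀ v₁ c₀ c₁ : ℝ)
    (h1 : ![a₀, a₁, 0] ∈ (graphPoly f g).newt)
    (h2 : ![a₀ + u₀, a₁ + u₁, 0] ∈ (graphPoly f g).newt)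
    (h3 : ![a₀ + v₀, a₁ + v₁, 0] ∈ (graphPoly f g).newt)
    (h4 : ![a₀ + u₀ + c₀, a₁ + u₁ + c₁, 1] ∈ (graphPoly f g).newt)
    (h5 : ![a₀ + v₀ + c₀, a₁ + v₁ + c₁, 1] ∈ (graphPoly f g).newt)
    (h6 : ![a₀ + u₀ + v₀ + c₀, a₁ + u₁ + v₁ + c₁, 1] ∈ (graphPoly f g).newt) :
    2 / 3 * |u₀ * v₁ - u₁ * v₀| ≤ vol f g := by
  set N : Matrix (Fin 3) (Fin 3) ℝ := !![u₀, v₀, c₀; u₁, v₁, c₁; 0, 0, 1] with hN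
  have hdet : N.det = u₀ * v₁ - u₁ * v₀ := by
    simp [hN, Matrix.det_fin_three]
    ring
  have hmul : ∀ x y z : ℝ, ![a₀, a₁, 0] + N.mulVec ![x, y, z] =
      ![a₀ + u₀ * x + v₀ * y + c₀ * z, a₁ + u₁ * x + v₁ * y + c₁ * z, z] := by
    intro x y z
    funext k
    fin_cases k <;> simp [hN] <;> ring
  -- For h = 1 the eight vertices coincide in two pairs, so the region is an octahedron and six
  -- points suffice.
  have hsub := image_slab_subset (convex_newt (graphPoly f g)) (h := 1) N ![a₀, a₁, 0]
    (by rw [hmul]; simpa using h1) (by rw [hmul]; simpa using h5)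
    (by rw [hmul]; simpa using h4) (by rw [hmul]; simpa using h2)
    (by rw [hmul]; simpa using h3) (by rw [hmul]; simpa using h5)
    (by rw [hmul]; simpa using h6) (by rw [hmul]; simpa using h2)
  have := ENNReal.toReal_mono (volume_newt_ne_top _) (measure_mono (μ := volume) hsub)
  rw [volume_affine_image, hdet, volume_slab_Icc le_rfl, ENNReal.toReal_mul,
    ENNReal.toReal_ofReal (abs_nonneg _), ENNReal.toReal_ofReal (by norm_num)] at this
  unfold vol
  linarith

end TropPoly

namespace TropPoly

open MeasureTheory Set

/-! ### The two explicit pairs and their polytopes -/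

section Explicit

theorem pair_two (i : Fin 2 → ℤ) (x y : ℝ) : pair i ![x, y] = i 0 * x + i 1 * y := by
  simp [pair, Fin.sum_univ_two]

theorem f₁_ne_bot : f₁ ≠ ⊥ :=
  add_ne_bot (add_ne_bot (add_ne_bot (add_ne_bot (monomial_ne_bot _ _))))

theorem g₁_ne_bot : g₁ ≠ ⊥ :=
  add_ne_bot (add_ne_bot (add_ne_bot (add_ne_bot (monomial_ne_bot _ _))))

theorem f₂_ne_bot : f₂ ≠ ⊥ :=
  add_ne_bot (add_ne_bot (add_ne_bot (add_ne_bot (monomial_ne_bot _ _))))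

theorem g₂_ne_bot : g₂ ≠ ⊥ :=
  add_ne_bot (add_ne_bot (add_ne_bot (add_ne_bot (monomial_ne_bot _ _))))

theorem evalReal_five (c₁ c₂ c₃ c₄ c₅ : ℝ) (k₁ k₂ k₃ k₄ k₅ : Fin 2 → ℤ) (t : Fin 2 → ℝ) :
    (monomial c₁ k₁ + monomial c₂ k₂ + monomial c₃ k₃ + monomial c₄ k₄ +
      monomial c₅ k₅).evalReal t =
    max (max (max (max (c₁ + pair k₁ t) (c₂ + pair k₂ t)) (c₃ + pair k₃ t)) (c₄ + pair k₄ t))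
      (c₅ + pair k₅ t) := by
  have h := fun c k => monomial_ne_bot (n := 2) c k
  rw [evalReal_add (add_ne_bot (add_ne_bot (add_ne_bot (h _ _)))) (h _ _),
    evalReal_add (add_ne_bot (add_ne_bot (h _ _))) (h _ _),
    evalReal_add (add_ne_bot (h _ _)) (h _ _), evalReal_add (h _ _) (h _ _)]
  simp only [evalReal_monomial]

theorem evalReal_f₁ (x y : ℝ) : f₁.evalReal ![x, y] =
    max (max (max (max (x + y) (-1 + 2 * y)) x) y) 0 := by
  rw [f₁, evalReal_five]
  simp [pair_two]

theorem evalReal_g₁ (x y : ℝ) : g₁.evalReal ![x, y] =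
    max (max (max (max (-1 + (x + 2 * y)) (x + y)) (-1 + 2 * y)) x) y := by
  rw [g₁, evalReal_five]
  simp [pair_two]

theorem evalReal_f₂ (x y : ℝ) : f₂.evalReal ![x, y] =
    max (max (max (max (2 * x) (x + y)) (-1 + 2 * y)) x) (-1 + y) := by
  rw [f₂, evalReal_five]
  simp [pair_two]

theorem evalReal_g₂ (x y : ℝ) : g₂.evalReal ![x, y] =
    max (max (max (max (-1 + (2 * x + y)) (-1 + (x + 2 * y))) (2 * x)) (x + y))
      (-1 + 2 * y) := by
  rw [g₂, evalReal_five]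
  simp [pair_two]

/-- The function `f₁ ⊘ g₁` in closed form. -/
noncomputable def phi (x y : ℝ) : ℝ :=
  min (max (-x) 0) (max (-y) 0) - min (max x 0) (max (y - 1) 0)

/-- Grouped by powers of x, both polynomials have degree one with coefficients depending on y, whose
maxima are resolved on y ≤ 0, 0 ≤ y ≤ 1 and y ≥ 1. -/
theorem evalReal_f₁_sub_g₁ (x y : ℝ) :
    f₁.evalReal ![x, y] - g₁.evalReal ![x, y] = phi x y := by
  have hf : f₁.evalReal ![x, y] = max (max (max 0 y) (-1 + 2 * y)) (x + max 0 y) := by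
    rw [evalReal_f₁, ← max_add_add_left, add_zero]
    ac_rfl
  have hg : g₁.evalReal ![x, y] =
      max (max y (-1 + 2 * y)) (x + max (max 0 y) (-1 + 2 * y)) := by
    rw [evalReal_g₁, ← max_add_add_left, ← max_add_add_left, add_zero, add_left_comm]
    simp only [max_comm, max_left_comm, max_assoc]
  rw [hf, hg, phi]
  rcases le_total y 0 with h | h
  · simp (disch := grind) only [max_eq_left, max_eq_right, min_eq_right]
    grind
  rcases le_total y 1 with h' | h'
  · simp (disch := grind) only [max_eq_left, max_eq_right, min_eq_right]
    grind
  · simp (disch := grind) only [max_eq_left, max_eq_right, min_eq_right]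
    grind

/-- With y = x + v the power of x is the total degree. The degrees are 1, 2 in the numerator and 2,
3 in the denominator, so both again have two groups, with coefficients depending on v. -/
theorem evalReal_f₂_sub_g₂ (x y : ℝ) :
    f₂.evalReal ![x, y] - g₂.evalReal ![x, y] = phi x y := by
  obtain ⟨v, rfl⟩ : ∃ v, y = x + v := ⟨y - x, by ring⟩
  have hf : f₂.evalReal ![x, x + v] =
      max (x + max 0 (-1 + v)) (2 * x + max (max 0 v) (-1 + 2 * v)) := by
    rw [evalReal_f₂]
    simp only [← max_add_add_left, add_zero]
    ring_nf
    ac_rfl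
  have hg : g₂.evalReal ![x, x + v] =
      max (2 * x + max (max 0 v) (-1 + 2 * v)) (3 * x + max (-1 + v) (-1 + 2 * v)) := by
    rw [evalReal_g₂]
    simp only [← max_add_add_left, add_zero]
    ring_nf
    ac_rfl
  rw [hf, hg, phi]
  rcases le_total v 0 with h | h
  · simp (disch := grind) only [max_eq_left, min_eq_left, min_eq_right]
    grind
  rcases le_total v 1 with h' | h'
  · simp (disch := grind) only [max_eq_left, max_eq_right, min_eq_right]
    grind
  · simp (disch := grind) only [max_eq_right, min_eq_left, min_eq_right]
    grind

theorem coeff_five_of_ne {c₁ c₂ c₃ c₄ c₅ : ℝ} {k₁ k₂ k₃ k₄ k₅ : Fin 2 → ℤ} {i : Fin 2 → ℤ}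
    (h : (monomial c₁ k₁ + monomial c₂ k₂ + monomial c₃ k₃ + monomial c₄ k₄ +
      monomial c₅ k₅).coeff i ≠ ⊥) : i = k₁ ∨ i = k₂ ∨ i = k₃ ∨ i = k₄ ∨ i = k₅ := by
  by_contra hne
  push Not at hne
  obtain ⟨h1, h2, h3, h4, h5⟩ := hne
  exact h (by simp [coeff_add, coeff_monomial, h1, h2, h3, h4, h5])

theorem vec_eq_iff {a b c d : ℤ} : (![a, b] : Fin 2 → ℤ) = ![c, d] ↔ a = c ∧ b = d := by
  simp

theorem coeff_f₁_ne_bot {a b : ℤ} (h : f₁.coeff ![a, b] ≠ ⊥) :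
    (a = 1 ∧ b = 1) ∨ (a = 0 ∧ b = 2) ∨ (a = 1 ∧ b = 0) ∨ (a = 0 ∧ b = 1) ∨
      (a = 0 ∧ b = 0) := by
  simpa only [vec_eq_iff] using coeff_five_of_ne h

theorem coeff_g₁_ne_bot {a b : ℤ} (h : g₁.coeff ![a, b] ≠ ⊥) :
    (a = 1 ∧ b = 2) ∨ (a = 1 ∧ b = 1) ∨ (a = 0 ∧ b = 2) ∨ (a = 1 ∧ b = 0) ∨
      (a = 0 ∧ b = 1) := by
  simpa only [vec_eq_iff] using coeff_five_of_ne h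

theorem coeff_f₂_ne_bot {a b : ℤ} (h : f₂.coeff ![a, b] ≠ ⊥) :
    (a = 2 ∧ b = 0) ∨ (a = 1 ∧ b = 1) ∨ (a = 0 ∧ b = 2) ∨ (a = 1 ∧ b = 0) ∨
      (a = 0 ∧ b = 1) := by
  simpa only [vec_eq_iff] using coeff_five_of_ne h

theorem coeff_g₂_ne_bot {a b : ℤ} (h : g₂.coeff ![a, b] ≠ ⊥) :
    (a = 2 ∧ b = 1) ∨ (a = 1 ∧ b = 2) ∨ (a = 2 ∧ b = 0) ∨ (a = 1 ∧ b = 1) ∨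
      (a = 0 ∧ b = 2) := by
  simpa only [vec_eq_iff] using coeff_five_of_ne h

theorem coeff_f₁_values : f₁.coeff ![1, 1] = (0 : ℝ) ∧ f₁.coeff ![0, 2] = (-1 : ℝ) ∧
    f₁.coeff ![1, 0] = (0 : ℝ) ∧ f₁.coeff ![0, 1] = (0 : ℝ) ∧ f₁.coeff ![0, 0] = (0 : ℝ) := by
  refine ⟨?_, ?_, ?_, ?_, ?_⟩ <;> simp [f₁, coeff_add, coeff_monomial]

theorem coeff_g₁_values : g₁.coeff ![1, 2] = (-1 : ℝ) ∧ g₁.coeff ![1, 1] = (0 : ℝ) ∧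
    g₁.coeff ![0, 2] = (-1 : ℝ) ∧ g₁.coeff ![1, 0] = (0 : ℝ) ∧ g₁.coeff ![0, 1] = (0 : ℝ) := by
  refine ⟨?_, ?_, ?_, ?_, ?_⟩ <;> simp [g₁, coeff_add, coeff_monomial]

theorem coeff_f₂_values : f₂.coeff ![2, 0] = (0 : ℝ) ∧ f₂.coeff ![1, 1] = (0 : ℝ) ∧
    f₂.coeff ![0, 2] = (-1 : ℝ) ∧ f₂.coeff ![1, 0] = (0 : ℝ) ∧ f₂.coeff ![0, 1] = (-1 : ℝ) := by
  refine ⟨?_, ?_, ?_, ?_, ?_⟩ <;> simp [f₂, coeff_add, coeff_monomial]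

theorem coeff_g₂_values : g₂.coeff ![2, 1] = (-1 : ℝ) ∧ g₂.coeff ![1, 2] = (-1 : ℝ) ∧
    g₂.coeff ![2, 0] = (0 : ℝ) ∧ g₂.coeff ![1, 1] = (0 : ℝ) ∧ g₂.coeff ![0, 2] = (-1 : ℝ) := by
  refine ⟨?_, ?_, ?_, ?_, ?_⟩ <;> simp [g₂, coeff_add, coeff_monomial]

theorem mem_slab {x y z : ℝ} : ![x, y, z] ∈ slab (Icc 0 1) 2 ↔
    (0 ≤ x ∧ x ≤ 1) ∧ (0 ≤ z ∧ z ≤ 1) ∧ (0 ≤ y ∧ z - x ≤ y) ∧ y ≤ 2 ∧ y ≤ 2 + (z - x) := by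
  simp [slab, ← min_add_add_left]

theorem newt_f₁_g₁ : (graphPoly f₁ g₁).newt = slab (Icc 0 1) 2 := by
  refine Subset.antisymm (newt_graphPoly_subset (convex_slab 2) ?_ ?_) ?_
  · intro a b h
    rw [mem_slab]
    rcases coeff_f₁_ne_bot h with ⟨rfl, rfl⟩ | ⟨rfl, rfl⟩ | ⟨rfl, rfl⟩ | ⟨rfl, rfl⟩ |
      ⟨rfl, rfl⟩ <;> norm_num
  · intro a b h
    rw [mem_slab]
    rcases coeff_g₁_ne_bot h with ⟨rfl, rfl⟩ | ⟨rfl, rfl⟩ | ⟨rfl, rfl⟩ | ⟨rfl, rfl⟩ |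
      ⟨rfl, rfl⟩ <;> norm_num
  · obtain ⟨f11, f02, f10, f01, f00⟩ := coeff_f₁_values
    obtain ⟨g12, g11, g02, g10, g01⟩ := coeff_g₁_values
    have lo := fun a b h => lower_mem_newt (f := f₁) (g := g₁) (a := a) (b := b) h
    have up := fun a b h => upper_mem_newt (f := f₁) (g := g₁) (a := a) (b := b) h
    refine slab_subset (convex_newt _) ?_ ?_ ?_ ?_ ?_ ?_ ?_ ?_
    · simpa using lo 0 0 (by simp [f00])
    · simpa using up 0 1 (by simp [g01])
    · simpa using up 1 0 (by simp [g10])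
    · simpa using lo 1 0 (by simp [f10])
    · simpa using lo 0 2 (by simp [f02])
    · simpa using up 0 2 (by simp [g02])
    · simpa using up 1 2 (by simp [g12])
    · have := lo 1 1 (by simp [f11])
      norm_num at this ⊢
      exact this

theorem vol_f₁_g₁ : vol f₁ g₁ = 5 / 3 := by
  rw [vol, newt_f₁_g₁, volume_slab_Icc (by norm_num), ENNReal.toReal_ofReal (by norm_num)]
  norm_num

/-- The linear part of the affine map that carries the first polytope to the second. -/
def shear : Matrix (Fin 3) (Fin 3) ℝ := !![-1, -1, 1; 0, 1, 0; 0, 0, 1]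

theorem shear_apply (x y z : ℝ) :
    ![2, 0, 0] + shear.mulVec ![x, y, z] = ![2 - x - y + z, y, z] := by
  funext k
  fin_cases k <;> (simp [shear]; try ring)

theorem newt_f₂_g₂ :
    (graphPoly f₂ g₂).newt = (fun p => ![2, 0, 0] + shear.mulVec p) '' slab (Icc 0 1) 2 := by
  refine Subset.antisymm (newt_graphPoly_subset ?_ ?_ ?_) ?_
  · rw [← image_image (fun p => ![2, 0, 0] + p) shear.mulVec]
    exact ((convex_slab 2).is_linear_image (Matrix.toLin' shear).isLinear).translate _
  · intro a b h
    -- The map (x, y, z) ↦ (2 - x - y + z, y, z) is an involution, so the preimage is given by the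
    -- same formula.
    refine ⟨![2 - a - b + 0, b, 0], ?_, (shear_apply _ _ _).trans (by congr 1; ring)⟩
    rw [mem_slab]
    rcases coeff_f₂_ne_bot h with ⟨rfl, rfl⟩ | ⟨rfl, rfl⟩ | ⟨rfl, rfl⟩ | ⟨rfl, rfl⟩ |
      ⟨rfl, rfl⟩ <;> norm_num
  · intro a b h
    refine ⟨![2 - a - b + 1, b, 1], ?_, (shear_apply _ _ _).trans (by congr 1; ring)⟩
    rw [mem_slab]
    rcases coeff_g₂_ne_bot h with ⟨rfl, rfl⟩ | ⟨rfl, rfl⟩ | ⟨rfl, rfl⟩ | ⟨rfl, rfl⟩ |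
      ⟨rfl, rfl⟩ <;> norm_num
  · obtain ⟨f20, f11, f02, f10, f01⟩ := coeff_f₂_values
    obtain ⟨g21, g12, g20, g11, g02⟩ := coeff_g₂_values
    have lo := fun a b h => lower_mem_newt (f := f₂) (g := g₂) (a := a) (b := b) h
    have up := fun a b h => upper_mem_newt (f := f₂) (g := g₂) (a := a) (b := b) h
    refine image_slab_subset (convex_newt _) _ _ ?_ ?_ ?_ ?_ ?_ ?_ ?_ ?_ <;> rw [shear_apply]
    · simpa using lo 2 0 (by simp [f20])
    · convert up 2 1 (by simp [g21]) using 2 <;> norm_num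
    · convert up 2 0 (by simp [g20]) using 2 <;> norm_num
    · convert lo 1 0 (by simp [f10]) using 2 <;> norm_num
    · convert lo 0 2 (by simp [f02]) using 2 <;> norm_num
    · convert up 1 2 (by simp [g12]) using 2 <;> norm_num
    · convert up 0 2 (by simp [g02]) using 2 <;> norm_num
    · convert lo 0 1 (by simp [f01]) using 2 <;> norm_num

theorem vol_f₂_g₂ : vol f₂ g₂ = 5 / 3 := by
  have : shear.det = -1 := by simp [shear, Matrix.det_fin_three]
  rw [vol, newt_f₂_g₂, volume_affine_image, this, volume_slab_Icc (by norm_num),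
    ENNReal.toReal_mul, ENNReal.toReal_ofReal (by norm_num), ENNReal.toReal_ofReal (by norm_num)]
  norm_num

/-- The first polytope has width 1 in the first coordinate; the second contains points with first
coordinates 0 and 2. -/
theorem newt_f₂_g₂_ne_translate (v : Fin 3 → ℝ) :
    (graphPoly f₂ g₂).newt ≠ (fun p => v + p) '' (graphPoly f₁ g₁).newt := by
  intro h
  obtain ⟨f20, -, f02, -, -⟩ := coeff_f₂_values
  have h1 := lower_mem_newt (f := f₂) (g := g₂) (a := 2) (b := 0) (by simp [f20])
  have h2 := lower_mem_newt (f := f₂) (g := g₂) (a := 0) (b := 2) (by simp [f02])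
  rw [h, newt_f₁_g₁] at h1 h2
  obtain ⟨p, hp, e1⟩ := h1
  obtain ⟨q, hq, e2⟩ := h2
  have e1 := congrFun e1 0
  have e2 := congrFun e2 0
  simp at e1 e2
  have := hp.1.2
  have := hq.1.1
  linarith

theorem not_sameUpToMonomial : ¬ SameUpToMonomial f₁ g₁ f₂ g₂ := by
  rintro ⟨c, k, hf, -⟩
  obtain ⟨f20, -, f02, -, -⟩ := coeff_f₂_values
  have key : ∀ a b : ℤ, f₂.coeff ![a, b] ≠ ⊥ → a - k 0 = 0 ∨ a - k 0 = 1 := by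
    intro a b h
    rw [hf, coeff_monomial_mul_ne_bot] at h
    have e : ![a, b] - k = ![a - k 0, b - k 1] := by
      funext l
      fin_cases l <;> rfl
    rw [e] at h
    have := coeff_f₁_ne_bot h
    omega
  have h1 := key 2 0 (by simp [f20])
  have h2 := key 0 2 (by simp [f02])
  omega

/-- The volume is at least `7/3` if the polytope contains two regions, of heights `2` and `1`,
over adjacent unit intervals. -/
theorem le_vol_of_two_slabs {f g : TropPoly 2} {a₀ a₁ b₀ b₁ : ℝ} (hab : |a₀ - b₀| = 1)
    (ha : ∀ x y z : ℝ, ![x, y, z] ∈ slab (Icc 0 1) 2 →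
      ![a₀ + x, a₁ + y, z] ∈ (graphPoly f g).newt)
    (hb : ∀ x y z : ℝ, ![x, y, z] ∈ slab (Icc 0 1) 1 →
      ![b₀ + x, b₁ + y, z] ∈ (graphPoly f g).newt) : 7 / 3 ≤ vol f g := by
  have hsub : ∀ h, slab (Ioo 0 1) h ⊆ slab (Icc 0 1) h := fun h p hp =>
    ⟨Ioo_subset_Icc_self hp.1, hp.2⟩
  have hv : ∀ p : Fin 3 → ℝ, p = ![p 0, p 1, p 2] := by
    intro p
    funext k
    fin_cases k <;> rfl
  -- Open intervals make the two translates disjoint at no cost in volume; the sum is (2 - 1/3) + (1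
  -- - 1/3) = 7/3.
  set A := (fun p => ![a₀, a₁, 0] + p) '' slab (Ioo 0 1) 2 with hA
  set B := (fun p => ![b₀, b₁, 0] + p) '' slab (Ioo 0 1) 1 with hB
  have hAn : A ⊆ (graphPoly f g).newt := by
    rintro _ ⟨p, hp, rfl⟩
    convert ha (p 0) (p 1) (p 2) (hv p ▸ hsub 2 hp) using 1
    funext k
    fin_cases k <;> simp
  have hBn : B ⊆ (graphPoly f g).newt := by
    rintro _ ⟨p, hp, rfl⟩
    convert hb (p 0) (p 1) (p 2) (hv p ▸ hsub 1 hp) using 1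
    funext k
    fin_cases k <;> simp
  have hdisj : Disjoint A B := by
    rw [Set.disjoint_left]
    rintro _ ⟨p, hp, rfl⟩ ⟨q, hq, e⟩
    have e := congrFun e 0
    simp at e
    have h1 := hp.1
    have h2 := hq.1
    simp only [mem_Ioo] at h1 h2
    rcases abs_cases (a₀ - b₀) with h | h <;> linarith
  have hBm : MeasurableSet B := by
    rw [hB, image_add_left]
    exact (measurable_const_add _) (measurableSet_slab measurableSet_Ioo 1)
  have := ENNReal.toReal_mono (volume_newt_ne_top _)
    (measure_mono (μ := volume) (union_subset hAn hBn))
  rw [measure_union hdisj hBm, hA, hB, image_add_left, image_add_left, measure_preimage_add,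
    measure_preimage_add, volume_slab_Ioo one_le_two, volume_slab_Ioo le_rfl,
    ← ENNReal.ofReal_add (by norm_num) (by norm_num), ENNReal.toReal_ofReal (by norm_num)] at this
  unfold vol
  linarith

end Explicit

end TropPoly

namespace TropPoly

/-! ### Leading exponents in generic directions -/

section Asymptotics

/-- The positively homogeneous function that is asymptotic to `phi`. -/
noncomputable def phiRec (x y : ℝ) : ℝ :=
  min (max (-x) 0) (max (-y) 0) - min (max x 0) (max y 0)

/-- The two functions differ only in y - 1 against y inside the subtracted minimum, which changes it
by at most 1. -/
theorem phi_smul_bounds {s : ℝ} (hs : 0 < s) (x y : ℝ) :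
    s * phiRec x y ≤ phi (s * x) (s * y) ∧ phi (s * x) (s * y) ≤ s * phiRec x y + 1 := by
  have e : s * phiRec x y = min (max (-(s * x)) 0) (max (-(s * y)) 0) -
      min (max (s * x) 0) (max (s * y) 0) := by
    simp only [phiRec, mul_sub, mul_min_of_nonneg _ _ hs.le, mul_max_of_nonneg _ _ hs.le,
      mul_neg, mul_zero]
  rw [e, phi]
  have h1 : min (max (s * x) 0) (max (s * y - 1) 0) ≤ min (max (s * x) 0) (max (s * y) 0) :=
    min_le_min le_rfl (max_le_max (by linarith) le_rfl)
  have h2 : min (max (s * x) 0) (max (s * y) 0) ≤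
      min (max (s * x) 0) (max (s * y - 1) 0) + 1 := by
    rw [← min_add_add_right, ← max_add_add_right]
    refine min_le_min (max_le_max (by linarith) (by norm_num)) ?_
    rw [← max_add_add_right, sub_add_cancel]
    exact max_le_max le_rfl (by norm_num)
  constructor <;> linarith

theorem pair_smul {n : ℕ} (i : Fin n → ℤ) (s : ℝ) (u : Fin n → ℝ) :
    pair i (s • u) = s * pair i u := by
  simp only [pair, Pi.smul_apply, smul_eq_mul, Finset.mul_sum]
  exact Finset.sum_congr rfl fun k _ => by ring

/-- Along a ray the exponent that is maximal in its direction gives the slope; the finitely many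
coefficients contribute an error independent of s. -/
theorem exists_evalReal_smul_bounds {n : ℕ} {f : TropPoly n} {w : Fin n → ℤ}
    (hw : f.coeff w ≠ ⊥) {u : Fin n → ℝ} (hmax : ∀ i, f.coeff i ≠ ⊥ → pair i u ≤ pair w u) :
    ∃ C : ℝ, ∀ s : ℝ, 0 < s → |f.evalReal (s • u) - s * pair w u| ≤ C := by
  have hf : f ≠ ⊥ := by
    rintro rfl
    exact hw rfl
  obtain ⟨C, hC⟩ := (f.finite_support.image f.realCoeff).bddAbove
  refine ⟨|C| + |f.realCoeff w|, fun s hs => ?_⟩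
  have h1 := le_evalReal hw (s • u)
  rw [pair_smul] at h1
  obtain ⟨i, hi, e⟩ := exists_evalReal_eq hf (s • u)
  have h2 := hC (Set.mem_image_of_mem _ hi)
  have h3 := mul_le_mul_of_nonneg_left (hmax i hi) hs.le
  rw [pair_smul] at e
  rw [abs_le]
  constructor <;> linarith [le_abs_self C, neg_abs_le (f.realCoeff w), abs_nonneg C,
    abs_nonneg (f.realCoeff w)]

theorem eq_zero_of_forall_mul_le {a K : ℝ} (h : ∀ s : ℝ, 0 < s → |s * a| ≤ K) : a = 0 := by
  by_contra ha
  have hK : 0 ≤ K := (abs_nonneg _).trans (h 1 one_pos)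
  have hpos := abs_pos.2 ha
  have := h ((K + 1) / |a|) (by positivity)
  rw [abs_mul, abs_of_pos (by positivity : 0 < (K + 1) / |a|), div_mul_cancel₀ _ hpos.ne'] at this
  linarith

/-- The pair `(f, g)` expresses the function `phi`. -/
structure Expresses (f g : TropPoly 2) : Prop where
  left_ne : f ≠ ⊥
  right_ne : g ≠ ⊥
  eval_eq : ∀ x y : ℝ, f.evalReal ![x, y] = g.evalReal ![x, y] + phi x y

/-- Along the ray both sides of f - g = `phi` are linear in s up to a bounded error, so their slopes
agree. -/
theorem Expresses.pair_sub_pair {f g : TropPoly 2} (h : Expresses f g) {w w' : Fin 2 → ℤ}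
    (hw : f.coeff w ≠ ⊥) (hw' : g.coeff w' ≠ ⊥) {x y : ℝ}
    (hmax : ∀ i, f.coeff i ≠ ⊥ → pair i ![x, y] ≤ pair w ![x, y])
    (hmax' : ∀ i, g.coeff i ≠ ⊥ → pair i ![x, y] ≤ pair w' ![x, y]) :
    pair w ![x, y] - pair w' ![x, y] = phiRec x y := by
  obtain ⟨C, hC⟩ := exists_evalReal_smul_bounds hw hmax
  obtain ⟨C', hC'⟩ := exists_evalReal_smul_bounds hw' hmax'
  rw [← sub_eq_zero]
  refine eq_zero_of_forall_mul_le (K := C + C' + 1) fun s hs => ?_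
  have h1 := abs_le.1 (hC s hs)
  have h2 := abs_le.1 (hC' s hs)
  obtain ⟨h3, h4⟩ := phi_smul_bounds hs x y
  have e : s • ![x, y] = ![s * x, s * y] := by
    funext k
    fin_cases k <;> simp
  have h5 := h.eval_eq (s * x) (s * y)
  rw [e] at h1 h2
  rw [abs_le]
  constructor <;> linarith

/-- `w` is the largest element of the support of `f` with respect to the lexicographic order
given by the functionals `e` and `e'`. -/
def IsLexMax (f : TropPoly 2) (e₀ e₁ e₀' e₁' a b : ℤ) : Prop :=
  f.coeff ![a, b] ≠ ⊥ ∧ ∀ i j, f.coeff ![i, j] ≠ ⊥ → e₀ * i + e₁ * j ≤ e₀ * a + e₁ * b ∧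
    (e₀ * i + e₁ * j = e₀ * a + e₁ * b → e₀' * i + e₁' * j ≤ e₀' * a + e₁' * b)

theorem lex_le_of_le {N p q : ℤ} (hq : |q| < N) (h : N * p + q ≤ 0) : p ≤ 0 ∧ (p = 0 → q ≤ 0) := by
  have := abs_lt.1 hq
  refine ⟨?_, fun hp => by subst hp; linarith⟩
  by_contra hp
  have : 1 ≤ p := by omega
  nlinarith

theorem exists_support_bound (f : TropPoly 2) :
    ∃ K : ℤ, ∀ a b, f.coeff ![a, b] ≠ ⊥ → |a| ≤ K ∧ |b| ≤ K := by
  obtain ⟨K, hK⟩ := (f.finite_support.image fun i => max |i 0| |i 1|).bddAbove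
  refine ⟨K, fun a b h => ?_⟩
  have := hK (Set.mem_image_of_mem _ h)
  simpa using this

theorem vec_eta (i : Fin 2 → ℤ) : ![i 0, i 1] = i := by
  funext k
  fin_cases k <;> rfl

/-- On a finite support a lexicographic order is given by one integer functional with a large weight
on its first part. `D` bounds the second part on differences of exponents, so the weight `D + 1`
finds the maximum, and this maximum serves for every N ≥ `D`. -/
theorem exists_isLexMax {f : TropPoly 2} (hf : f ≠ ⊥) (e₀ e₁ e₀' e₁' : ℤ) :
    ∃ a b N₀ : ℤ, IsLexMax f e₀ e₁ e₀' e₁' a b ∧ ∀ N, N₀ ≤ N → ∀ i, f.coeff i ≠ ⊥ →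
      pair i ![((N * e₀ + e₀' : ℤ) : ℝ), ((N * e₁ + e₁' : ℤ) : ℝ)] ≤
      pair ![a, b] ![((N * e₀ + e₀' : ℤ) : ℝ), ((N * e₁ + e₁' : ℤ) : ℝ)] := by
  obtain ⟨K, hK⟩ := exists_support_bound f
  set D : ℤ := 2 * K * |e₀'| + 2 * K * |e₁'| with hD
  have hbd : ∀ a b i j, f.coeff ![a, b] ≠ ⊥ → f.coeff ![i, j] ≠ ⊥ →
      |e₀' * (i - a) + e₁' * (j - b)| ≤ D := by
    intro a b i j h h'
    have h1 := hK a b h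
    have h2 := hK i j h'
    refine (abs_add_le _ _).trans ?_
    rw [abs_mul, abs_mul]
    have h3 : |i - a| ≤ 2 * K := (abs_sub _ _).trans (by linarith)
    have h4 : |j - b| ≤ 2 * K := (abs_sub _ _).trans (by linarith)
    nlinarith [abs_nonneg e₀', abs_nonneg e₁']
  obtain ⟨w, hw, hmax⟩ := Finset.exists_max_image f.support
    (fun i => (D + 1) * (e₀ * i 0 + e₁ * i 1) + (e₀' * i 0 + e₁' * i 1)) (support_nonempty hf)
  have hw' : f.coeff ![w 0, w 1] ≠ ⊥ := by
    rw [vec_eta]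
    exact mem_support.1 hw
  have hlex : IsLexMax f e₀ e₁ e₀' e₁' (w 0) (w 1) := by
    refine ⟨hw', fun i j hij => ?_⟩
    have h1 := hmax _ (mem_support.2 hij)
    simp only [Matrix.cons_val_zero, Matrix.cons_val_one] at h1
    have h2 := lex_le_of_le (N := D + 1) (p := e₀ * (i - w 0) + e₁ * (j - w 1))
      (Int.lt_add_one_iff.2 (hbd _ _ i j hw' hij)) (by linarith)
    refine ⟨by linarith, fun e => ?_⟩
    have := h2.2 (by linarith)
    linarith
  refine ⟨w 0, w 1, D, hlex, fun N hN i hi => ?_⟩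
  rw [pair_two, pair_two]
  norm_cast
  rw [← vec_eta i] at hi
  have h1 := hlex.2 _ _ hi
  have h2 := abs_le.1 (hbd _ _ _ _ hw' hi)
  simp only [Matrix.cons_val_zero, Matrix.cons_val_one]
  have key : N * (e₀ * (i 0 - w 0) + e₁ * (i 1 - w 1)) +
      (e₀' * (i 0 - w 0) + e₁' * (i 1 - w 1)) ≤ 0 := by
    rcases h1.1.eq_or_lt with e | e
    · have := h1.2 e
      have e0 : e₀ * (i 0 - w 0) + e₁ * (i 1 - w 1) = 0 := by linarith
      rw [e0]
      linarith
    · have hle : e₀ * (i 0 - w 0) + e₁ * (i 1 - w 1) ≤ -1 := by linarith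
      nlinarith [(abs_nonneg _).trans (hbd _ _ _ _ hw' hw')]
  linarith

/-- In a generic direction, the leading exponents of `f` and `g` differ by the gradient `d` of
`phi` in that direction. -/
theorem Expresses.exists_isLexMax {f g : TropPoly 2} (h : Expresses f g)
    {e₀ e₁ e₀' e₁' : ℤ} (d₀ d₁ : ℤ) (hdet : |e₀ * e₁' - e₁ * e₀'| = 1)
    (hd : ∀ N : ℝ, 2 ≤ N → phiRec (N * e₀ + e₀') (N * e₁ + e₁') =
      d₀ * (N * e₀ + e₀') + d₁ * (N * e₁ + e₁')) :
    ∃ a b, IsLexMax f e₀ e₁ e₀' e₁' (a + d₀) (b + d₁) ∧ IsLexMax g e₀ e₁ e₀' e₁' a b := by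
  obtain ⟨a, b, N₁, hl, hm⟩ := TropPoly.exists_isLexMax h.left_ne e₀ e₁ e₀' e₁'
  obtain ⟨a', b', N₂, hl', hm'⟩ := TropPoly.exists_isLexMax h.right_ne e₀ e₁ e₀' e₁'
  refine ⟨a', b', ?_, hl'⟩
  set q := e₀' * (a - a' - d₀) + e₁' * (b - b' - d₁) with hq
  set p := e₀ * (a - a' - d₀) + e₁ * (b - b' - d₁) with hp
  -- Neither p nor q depends on N, so a single N > |q| suffices: N p + q = 0 over the integers then
  -- forces p = q = 0.
  set N := max (max N₁ N₂) (max 2 (|q| + 1)) with hN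
  have hN1 : N₁ ≤ N := le_max_of_le_left (le_max_left _ _)
  have hN2 : N₂ ≤ N := le_max_of_le_left (le_max_right _ _)
  have hN3 : 2 ≤ N := le_max_of_le_right (le_max_left _ _)
  have hN4 : |q| < N := Int.lt_of_add_one_le (le_max_of_le_right (le_max_right _ _))
  have key := h.pair_sub_pair hl.1 hl'.1 (hm N hN1) (hm' N hN2)
  rw [pair_two, pair_two] at key
  have hd' := hd N (by exact_mod_cast hN3)
  push_cast at key
  rw [hd'] at key
  norm_cast at key
  have hz : N * p + q = 0 := by
    rw [hp, hq]
    linarith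
  have l1 := lex_le_of_le hN4 hz.le
  have l2 := lex_le_of_le (N := N) (p := -p) (q := -q) (by rwa [abs_neg]) (by linarith)
  have hp0 : p = 0 := by omega
  have hq0 : q = 0 := by simpa [hp0] using hz
  have c1 : (e₀ * e₁' - e₁ * e₀') * (a - a' - d₀) = 0 := by
    linear_combination e₁' * hp0 - e₁ * hq0
  have c2 : (e₀ * e₁' - e₁ * e₀') * (b - b' - d₁) = 0 := by
    linear_combination e₀ * hq0 - e₀' * hp0
  have hne : e₀ * e₁' - e₁ * e₀' ≠ 0 := by
    intro h0
    simp [h0] at hdet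
  have ha := (mul_eq_zero.1 c1).resolve_left hne
  have hb := (mul_eq_zero.1 c2).resolve_left hne
  rw [show a' + d₀ = a by omega, show b' + d₁ = b by omega]
  exact hl

end Asymptotics

end TropPoly

namespace TropPoly

/-! ### The edges forced by `phi`, and the octahedra they span -/

section Shape

theorem coeff_ne_bot_of_eq {f : TropPoly 2} {a b a' b' : ℤ} (h : f.coeff ![a, b] ≠ ⊥)
    (ha : a' = a) (hb : b' = b) : f.coeff ![a', b'] ≠ ⊥ := by
  rwa [ha, hb]

/-- The Newton polygons of `f` and `g` have the directions of edges that `phi` forces: they lie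
in two hexagons whose sides they touch in prescribed ways. -/
structure Shape (f g : TropPoly 2) (x₀ x₁ y₀ y₁ m₀ m₁ : ℤ) : Prop where
  bound_f : ∀ i j, f.coeff ![i, j] ≠ ⊥ →
    x₀ ≤ i ∧ i ≤ x₁ ∧ y₀ ≤ j ∧ j ≤ y₁ ∧ m₀ ≤ i + j ∧ i + j ≤ m₁
  bound_g : ∀ i j, g.coeff ![i, j] ≠ ⊥ →
    x₀ ≤ i ∧ i ≤ x₁ ∧ y₀ ≤ j ∧ j ≤ y₁ ∧ m₀ + 1 ≤ i + j ∧ i + j ≤ m₁ + 1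
  left : ∃ l l', l + 1 ≤ l' ∧ f.coeff ![x₀, l] ≠ ⊥ ∧ f.coeff ![x₀, l'] ≠ ⊥ ∧
    g.coeff ![x₀, l + 1] ≠ ⊥ ∧ g.coeff ![x₀, l'] ≠ ⊥
  right : ∃ r r', r ≤ r' ∧ f.coeff ![x₁, r] ≠ ⊥ ∧ f.coeff ![x₁, r'] ≠ ⊥ ∧
    g.coeff ![x₁, r] ≠ ⊥ ∧ g.coeff ![x₁, r' + 1] ≠ ⊥
  bottom : ∃ p p', p + 1 ≤ p' ∧ f.coeff ![p, y₀] ≠ ⊥ ∧ f.coeff ![p', y₀] ≠ ⊥ ∧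
    g.coeff ![p + 1, y₀] ≠ ⊥ ∧ g.coeff ![p', y₀] ≠ ⊥
  top : ∃ t t', t ≤ t' ∧ f.coeff ![t, y₁] ≠ ⊥ ∧ f.coeff ![t', y₁] ≠ ⊥ ∧
    g.coeff ![t, y₁] ≠ ⊥ ∧ g.coeff ![t' + 1, y₁] ≠ ⊥
  low : ∃ s s', s ≤ s' ∧ f.coeff ![s, m₀ - s] ≠ ⊥ ∧ f.coeff ![s', m₀ - s'] ≠ ⊥ ∧
    g.coeff ![s, m₀ + 1 - s] ≠ ⊥ ∧ g.coeff ![s' + 1, m₀ - s'] ≠ ⊥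
  high : ∃ h h', h + 1 ≤ h' ∧ f.coeff ![h, m₁ - h] ≠ ⊥ ∧ f.coeff ![h', m₁ - h'] ≠ ⊥ ∧
    g.coeff ![h + 1, m₁ - h] ≠ ⊥ ∧ g.coeff ![h', m₁ + 1 - h'] ≠ ⊥

/-- The twelve directions are the two sides of each of the six rays along which `phiRec` breaks; the
last two arguments are its gradient there. -/
theorem Expresses.exists_shape {f g : TropPoly 2} (h : Expresses f g) :
    ∃ x₀ x₁ y₀ y₁ m₀ m₁, Shape f g x₀ x₁ y₀ y₁ m₀ m₁ := by
  obtain ⟨a1, b1, f1, g1⟩ := h.exists_isLexMax (e₀ := -1) (e₁ := 0) (e₀' := 0) (e₁' := -1) 0 (-1)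
    (by norm_num) (by intro N hN; simp only [phiRec]; grind)
  obtain ⟨a2, b2, f2, g2⟩ := h.exists_isLexMax (e₀ := -1) (e₁ := 0) (e₀' := 0) (e₁' := 1) 0 0
    (by norm_num) (by intro N hN; simp only [phiRec]; grind)
  obtain ⟨a3, b3, f3, g3⟩ := h.exists_isLexMax (e₀ := 1) (e₁ := 0) (e₀' := 0) (e₁' := -1) 0 0
    (by norm_num) (by intro N hN; simp only [phiRec]; grind)
  obtain ⟨a4, b4, f4, g4⟩ := h.exists_isLexMax (e₀ := 1) (e₁ := 0) (e₀' := 0) (e₁' := 1) 0 (-1)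
    (by norm_num) (by intro N hN; simp only [phiRec]; grind)
  obtain ⟨a5, b5, f5, g5⟩ := h.exists_isLexMax (e₀ := 0) (e₁ := -1) (e₀' := -1) (e₁' := 0) (-1) 0
    (by norm_num) (by intro N hN; simp only [phiRec]; grind)
  obtain ⟨a6, b6, f6, g6⟩ := h.exists_isLexMax (e₀ := 0) (e₁ := -1) (e₀' := 1) (e₁' := 0) 0 0
    (by norm_num) (by intro N hN; simp only [phiRec]; grind)
  obtain ⟨a7, b7, f7, g7⟩ := h.exists_isLexMax (e₀ := 0) (e₁ := 1) (e₀' := -1) (e₁' := 0) 0 0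
    (by norm_num) (by intro N hN; simp only [phiRec]; grind)
  obtain ⟨a8, b8, f8, g8⟩ := h.exists_isLexMax (e₀ := 0) (e₁ := 1) (e₀' := 1) (e₁' := 0) (-1) 0
    (by norm_num) (by intro N hN; simp only [phiRec]; grind)
  obtain ⟨a9, b9, f9, g9⟩ := h.exists_isLexMax (e₀ := -1) (e₁ := -1) (e₀' := -1) (e₁' := 0)
    0 (-1) (by norm_num) (by intro N hN; simp only [phiRec]; grind)
  obtain ⟨a10, b10, f10, g10⟩ := h.exists_isLexMax (e₀ := -1) (e₁ := -1) (e₀' := 1) (e₁' := 0)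
    (-1) 0 (by norm_num) (by intro N hN; simp only [phiRec]; grind)
  obtain ⟨a11, b11, f11, g11⟩ := h.exists_isLexMax (e₀ := 1) (e₁ := 1) (e₀' := -1) (e₁' := 0)
    (-1) 0 (by norm_num) (by intro N hN; simp only [phiRec]; grind)
  obtain ⟨a12, b12, f12, g12⟩ := h.exists_isLexMax (e₀ := 1) (e₁ := 1) (e₀' := 1) (e₁' := 0)
    0 (-1) (by norm_num) (by intro N hN; simp only [phiRec]; grind)
  -- The ends of an edge are compared in the polynomial whose edge is the shorter one: g for left,
  -- bottom and high, f for the others. The longer edge then has length at least 1.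
  have L := g1.2 _ _ g2.1
  have L' := g2.2 _ _ g1.1
  have R := f3.2 _ _ f4.1
  have R' := f4.2 _ _ f3.1
  have B := g5.2 _ _ g6.1
  have B' := g6.2 _ _ g5.1
  have T := f7.2 _ _ f8.1
  have T' := f8.2 _ _ f7.1
  have M := f9.2 _ _ f10.1
  have M' := f10.2 _ _ f9.1
  have H := g11.2 _ _ g12.1
  have H' := g12.2 _ _ g11.1
  -- The exponents found are those of g; the shifts by -1 add the gradient and pass to f.
  refine ⟨a1, a3, b5, b7, a9 + b9 - 1, a11 + b11 - 1, ?_, ?_, ⟨b1 - 1, b2, ?_⟩, ⟨b3, b4 - 1, ?_⟩,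
    ⟨a5 - 1, a6, ?_⟩, ⟨a7, a8 - 1, ?_⟩, ⟨a9, a10 - 1, ?_⟩, ⟨a11 - 1, a12, ?_⟩⟩
  · intro i j hij
    have := f1.2 i j hij
    have := f3.2 i j hij
    have := f5.2 i j hij
    have := f7.2 i j hij
    have := f9.2 i j hij
    have := f11.2 i j hij
    omega
  · intro i j hij
    have := g1.2 i j hij
    have := g3.2 i j hij
    have := g5.2 i j hij
    have := g7.2 i j hij
    have := g9.2 i j hij
    have := g11.2 i j hij
    omega
  · refine ⟨by omega, ?_, ?_, ?_, ?_⟩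
    · exact coeff_ne_bot_of_eq f1.1 (by omega) (by omega)
    · exact coeff_ne_bot_of_eq f2.1 (by omega) (by omega)
    · exact coeff_ne_bot_of_eq g1.1 (by omega) (by omega)
    · exact coeff_ne_bot_of_eq g2.1 (by omega) (by omega)
  · refine ⟨by omega, ?_, ?_, ?_, ?_⟩
    · exact coeff_ne_bot_of_eq f3.1 (by omega) (by omega)
    · exact coeff_ne_bot_of_eq f4.1 (by omega) (by omega)
    · exact coeff_ne_bot_of_eq g3.1 (by omega) (by omega)
    · exact coeff_ne_bot_of_eq g4.1 (by omega) (by omega)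
  · refine ⟨by omega, ?_, ?_, ?_, ?_⟩
    · exact coeff_ne_bot_of_eq f5.1 (by omega) (by omega)
    · exact coeff_ne_bot_of_eq f6.1 (by omega) (by omega)
    · exact coeff_ne_bot_of_eq g5.1 (by omega) (by omega)
    · exact coeff_ne_bot_of_eq g6.1 (by omega) (by omega)
  · refine ⟨by omega, ?_, ?_, ?_, ?_⟩
    · exact coeff_ne_bot_of_eq f7.1 (by omega) (by omega)
    · exact coeff_ne_bot_of_eq f8.1 (by omega) (by omega)
    · exact coeff_ne_bot_of_eq g7.1 (by omega) (by omega)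
    · exact coeff_ne_bot_of_eq g8.1 (by omega) (by omega)
  · refine ⟨by omega, ?_, ?_, ?_, ?_⟩
    · exact coeff_ne_bot_of_eq f9.1 (by omega) (by omega)
    · exact coeff_ne_bot_of_eq f10.1 (by omega) (by omega)
    · exact coeff_ne_bot_of_eq g9.1 (by omega) (by omega)
    · exact coeff_ne_bot_of_eq g10.1 (by omega) (by omega)
  · refine ⟨by omega, ?_, ?_, ?_, ?_⟩
    · exact coeff_ne_bot_of_eq f11.1 (by omega) (by omega)
    · exact coeff_ne_bot_of_eq f12.1 (by omega) (by omega)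
    · exact coeff_ne_bot_of_eq g11.1 (by omega) (by omega)
    · exact coeff_ne_bot_of_eq g12.1 (by omega) (by omega)

/-- Lattice points on an edge belong to the polytope even when they are not exponents of the
polynomial. -/
theorem step_mem {K : Set (Fin 3 → ℝ)} (hK : Convex ℝ K) {a b z u v n : ℝ} (hn : 1 ≤ n)
    (h1 : ![a, b, z] ∈ K) (h2 : ![a + n * u, b + n * v, z] ∈ K) : ![a + u, b + v, z] ∈ K := by
  have hn' : n ≠ 0 := by linarith
  have hle : n⁻¹ ≤ 1 := inv_le_one_of_one_le₀ hn
  convert hK h1 h2 (a := 1 - n⁻¹) (b := n⁻¹) (by linarith) (by positivity) (by ring) using 1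
  funext k
  fin_cases k <;> (simp; field_simp; try ring)

variable {f g : TropPoly 2} {x₀ x₁ y₀ y₁ m₀ m₁ : ℤ}

theorem lower_step_mem {a b u v n : ℤ} (hn : 1 ≤ n) (h1 : f.coeff ![a, b] ≠ ⊥)
    (h2 : f.coeff ![a + n * u, b + n * v] ≠ ⊥) :
    ![(a + u : ℝ), b + v, 0] ∈ (graphPoly f g).newt :=
  step_mem (convex_newt _) (n := n) (by exact_mod_cast hn) (lower_mem_newt h1)
    (by simpa using lower_mem_newt (g := g) h2)

theorem upper_step_mem {a b u v n : ℤ} (hn : 1 ≤ n) (h1 : g.coeff ![a, b] ≠ ⊥)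
    (h2 : g.coeff ![a + n * u, b + n * v] ≠ ⊥) :
    ![(a + u : ℝ), b + v, 1] ∈ (graphPoly f g).newt :=
  step_mem (convex_newt _) (n := n) (by exact_mod_cast hn) (upper_mem_newt h1)
    (by simpa using upper_mem_newt (f := f) h2)

theorem mem_of_eq {K : Set (Fin 3 → ℝ)} {a b a' b' z : ℝ} (h : ![a, b, z] ∈ K)
    (ha : a' = a) (hb : b' = b) : ![a', b', z] ∈ K := by
  rwa [ha, hb]

/-- The left edge of f and the right edge of g both have length at least 1. A unit segment on each,
completed by one end of the opposite edge of f and one of g, spans an octahedron whose determinant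
is the width up to sign. -/
theorem Shape.vol_ge_x (h : Shape f g x₀ x₁ y₀ y₁ m₀ m₁) :
    2 / 3 * ((x₁ : ℝ) - x₀) ≤ vol f g := by
  obtain ⟨l, l', hl, fl, fl', gl, -⟩ := h.left
  obtain ⟨r, r', hr, fr, -, gr, gr'⟩ := h.right
  have key := le_vol_of_octahedron (f := f) (g := g) x₀ l 0 1 (x₁ - x₀) (r - l) 0 0
    (lower_mem_newt fl)
    (mem_of_eq (lower_step_mem (u := 0) (v := 1) (n := l' - l) (by omega) fl
      (coeff_ne_bot_of_eq fl' (by omega) (by omega))) (by simp) (by simp))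
    (mem_of_eq (lower_mem_newt fr) (by ring) (by ring))
    (mem_of_eq (upper_mem_newt gl) (by simp) (by simp))
    (mem_of_eq (upper_mem_newt gr) (by ring) (by ring))
    (mem_of_eq (upper_step_mem (u := 0) (v := 1) (n := r' + 1 - r) (by omega) gr
      (coeff_ne_bot_of_eq gr' (by omega) (by omega))) (by simp) (by simp; ring))
  refine le_trans (mul_le_mul_of_nonneg_left ?_ (by norm_num)) key
  rw [← abs_neg]
  exact le_trans (by simp) (le_abs_self _)

theorem Shape.vol_ge_y (h : Shape f g x₀ x₁ y₀ y₁ m₀ m₁) :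
    2 / 3 * ((y₁ : ℝ) - y₀) ≤ vol f g := by
  obtain ⟨p, p', hp, fp, fp', gp, -⟩ := h.bottom
  obtain ⟨t, t', ht, ft, -, gt, gt'⟩ := h.top
  have key := le_vol_of_octahedron (f := f) (g := g) p y₀ 1 0 (t - p) (y₁ - y₀) 0 0
    (lower_mem_newt fp)
    (mem_of_eq (lower_step_mem (u := 1) (v := 0) (n := p' - p) (by omega) fp
      (coeff_ne_bot_of_eq fp' (by omega) (by omega))) (by simp) (by simp))
    (mem_of_eq (lower_mem_newt ft) (by ring) (by ring))
    (mem_of_eq (upper_mem_newt gp) (by simp) (by simp))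
    (mem_of_eq (upper_mem_newt gt) (by ring) (by ring))
    (mem_of_eq (upper_step_mem (u := 1) (v := 0) (n := t' + 1 - t) (by omega) gt
      (coeff_ne_bot_of_eq gt' (by omega) (by omega))) (by simp; ring) (by simp))
  refine le_trans (mul_le_mul_of_nonneg_left ?_ (by norm_num)) key
  exact le_trans (by simp) (le_abs_self _)

theorem Shape.vol_ge_m (h : Shape f g x₀ x₁ y₀ y₁ m₀ m₁) :
    2 / 3 * ((m₁ : ℝ) - m₀) ≤ vol f g := by
  obtain ⟨a, a', ha, fa, fa', ga, -⟩ := h.high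
  obtain ⟨s, s', hs, fs, -, gs, gs'⟩ := h.low
  -- The offset (0, 1) accounts for the exponents of g having total degrees larger by one.
  have key := le_vol_of_octahedron (f := f) (g := g) a (m₁ - a) 1 (-1) (s - a)
    (m₀ - s - (m₁ - a)) 0 1
    (mem_of_eq (lower_mem_newt fa) (by simp) (by simp))
    (mem_of_eq (lower_step_mem (u := 1) (v := -1) (n := a' - a) (by omega) fa
      (coeff_ne_bot_of_eq fa' (by omega) (by omega))) (by simp) (by simp))
    (mem_of_eq (lower_mem_newt fs) (by ring) (by push_cast; ring))
    (mem_of_eq (upper_mem_newt ga) (by simp) (by simp))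
    (mem_of_eq (upper_mem_newt gs) (by ring) (by push_cast; ring))
    (mem_of_eq (upper_step_mem (u := 1) (v := -1) (n := s' + 1 - s) (by omega) gs
      (coeff_ne_bot_of_eq gs' (by omega) (by omega))) (by push_cast; ring) (by push_cast; ring))
  refine le_trans (mul_le_mul_of_nonneg_left ?_ (by norm_num)) key
  rw [← abs_neg]
  exact le_trans (by linarith) (le_abs_self _)

/-- The exponents of `f₁` and `g₁`, shifted by `(a, b)`; the interior points of edges are
optional. -/
structure FirstSupport (f g : TropPoly 2) (a b : ℤ) : Prop where
  f00 : f.coeff ![a, b] ≠ ⊥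
  f10 : f.coeff ![a + 1, b] ≠ ⊥
  f11 : f.coeff ![a + 1, b + 1] ≠ ⊥
  f02 : f.coeff ![a, b + 2] ≠ ⊥
  g10 : g.coeff ![a + 1, b] ≠ ⊥
  g01 : g.coeff ![a, b + 1] ≠ ⊥
  g02 : g.coeff ![a, b + 2] ≠ ⊥
  g12 : g.coeff ![a + 1, b + 2] ≠ ⊥
  bound_f : ∀ i j, f.coeff ![i, j] ≠ ⊥ →
    a ≤ i ∧ i ≤ a + 1 ∧ b ≤ j ∧ j ≤ b + 2 ∧ i + j ≤ a + b + 2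
  bound_g : ∀ i j, g.coeff ![i, j] ≠ ⊥ →
    a ≤ i ∧ i ≤ a + 1 ∧ b ≤ j ∧ j ≤ b + 2 ∧ a + b + 1 ≤ i + j

/-- The exponents of `f₂` and `g₂`, shifted by `(a, b)`; the interior points of edges are
optional. -/
structure SecondSupport (f g : TropPoly 2) (a b : ℤ) : Prop where
  f20 : f.coeff ![a + 2, b] ≠ ⊥
  f02 : f.coeff ![a, b + 2] ≠ ⊥
  f10 : f.coeff ![a + 1, b] ≠ ⊥
  f01 : f.coeff ![a, b + 1] ≠ ⊥
  g21 : g.coeff ![a + 2, b + 1] ≠ ⊥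
  g12 : g.coeff ![a + 1, b + 2] ≠ ⊥
  g20 : g.coeff ![a + 2, b] ≠ ⊥
  g02 : g.coeff ![a, b + 2] ≠ ⊥
  bound_f : ∀ i j, f.coeff ![i, j] ≠ ⊥ →
    a ≤ i ∧ b ≤ j ∧ a + b + 1 ≤ i + j ∧ i + j ≤ a + b + 2
  bound_g : ∀ i j, g.coeff ![i, j] ≠ ⊥ →
    i ≤ a + 2 ∧ j ≤ b + 2 ∧ a + b + 2 ≤ i + j ∧ i + j ≤ a + b + 3

/-- The long edges leave no freedom within these widths: every prescribed point of contact is a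
determined lattice point. -/
theorem Shape.firstSupport (h : Shape f g x₀ x₁ y₀ y₁ m₀ m₁) (hx : x₁ ≤ x₀ + 1)
    (hy : y₁ = y₀ + 2) (hm : m₁ ≤ m₀ + 2) : FirstSupport f g x₀ y₀ := by
  have bf := h.bound_f
  have bg := h.bound_g
  obtain ⟨p, p', hp, fp, fp', gp, gp'⟩ := h.bottom
  obtain ⟨t, t', ht, ft, ft', gt, gt'⟩ := h.top
  obtain ⟨s, s', hs, fs, -, gs, -⟩ := h.low
  obtain ⟨q, q', hq, fq, fq', -, -⟩ := h.high
  have := bf _ _ fp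
  have := bf _ _ fp'
  have := bf _ _ ft
  have := bf _ _ ft'
  have := bf _ _ fs
  have := bf _ _ fq
  have := bf _ _ fq'
  have hM : m₀ = x₀ + y₀ := by omega
  have hm' : m₁ = x₀ + y₀ + 2 := by omega
  refine ⟨coeff_ne_bot_of_eq fp (by omega) (by omega),
    coeff_ne_bot_of_eq fp' (by omega) (by omega),
    coeff_ne_bot_of_eq fq' (by omega) (by omega),
    coeff_ne_bot_of_eq ft (by omega) (by omega),
    coeff_ne_bot_of_eq gp (by omega) (by omega),
    coeff_ne_bot_of_eq gs (by omega) (by omega),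
    coeff_ne_bot_of_eq gt (by omega) (by omega),
    coeff_ne_bot_of_eq gt' (by omega) (by omega), fun i j hij => ?_, fun i j hij => ?_⟩
  · have := bf i j hij
    omega
  · have := bg i j hij
    omega

theorem Shape.secondSupport (h : Shape f g x₀ x₁ y₀ y₁ m₀ m₁) (hx : x₁ = x₀ + 2)
    (hy : y₁ = y₀ + 2) (hm₀ : m₀ = x₀ + y₀ + 1) (hm₁ : m₁ = x₀ + y₀ + 2) :
    SecondSupport f g x₀ y₀ := by
  have bf := h.bound_f
  have bg := h.bound_g
  obtain ⟨l, l', hl, fl, fl', gl, gl'⟩ := h.left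
  obtain ⟨r, r', hr, fr, fr', gr, gr'⟩ := h.right
  obtain ⟨p, p', hp, fp, fp', gp, gp'⟩ := h.bottom
  obtain ⟨t, t', ht, ft, ft', gt, gt'⟩ := h.top
  have := bf _ _ fp
  have := bf _ _ fp'
  have := bf _ _ fl
  have := bf _ _ fl'
  have := bg _ _ gt
  have := bg _ _ gt'
  have := bg _ _ gr
  have := bg _ _ gr'
  refine ⟨coeff_ne_bot_of_eq fp' (by omega) (by omega),
    coeff_ne_bot_of_eq fl' (by omega) (by omega),
    coeff_ne_bot_of_eq fp (by omega) (by omega),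
    coeff_ne_bot_of_eq fl (by omega) (by omega),
    coeff_ne_bot_of_eq gr' (by omega) (by omega),
    coeff_ne_bot_of_eq gt' (by omega) (by omega),
    coeff_ne_bot_of_eq gr (by omega) (by omega),
    coeff_ne_bot_of_eq gt (by omega) (by omega), fun i j hij => ?_, fun i j hij => ?_⟩
  · have := bf i j hij
    omega
  · have := bg i j hij
    omega

end Shape

end TropPoly

namespace TropPoly

open Set

/-! ### Shapes of width two and the reduction to three cases -/

section Hexagons

theorem slab_translate_mem {K : Set (Fin 3 → ℝ)} (hK : Convex ℝ K) {h : ℝ} (a b : ℝ)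
    (h1 : ![a, b, 0] ∈ K) (h2 : ![a, b + 1, 1] ∈ K) (h3 : ![a + 1, b, 1] ∈ K)
    (h4 : ![a + 1, b, 0] ∈ K) (h5 : ![a, b + h, 0] ∈ K) (h6 : ![a, b + h, 1] ∈ K)
    (h7 : ![a + 1, b + h, 1] ∈ K) (h8 : ![a + 1, b + (h - 1), 0] ∈ K) (x y z : ℝ)
    (hp : ![x, y, z] ∈ slab (Icc 0 1) h) : ![a + x, b + y, z] ∈ K := by
  have e : ∀ x y z : ℝ, ![a, b, 0] + (1 : Matrix (Fin 3) (Fin 3) ℝ).mulVec ![x, y, z] =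
      ![a + x, b + y, z] := by
    intro x y z
    rw [Matrix.one_mulVec]
    funext k
    fin_cases k <;> simp
  rw [← e]
  refine image_slab_subset hK 1 ![a, b, 0] ?_ ?_ ?_ ?_ ?_ ?_ ?_ ?_ ⟨_, hp, rfl⟩ <;> rw [e]
  all_goals simpa only [add_zero]

variable {f g : TropPoly 2} {x₀ x₁ y₀ y₁ m₀ m₁ : ℤ}

/-- Here Newt(f) is a full triangle of side 2 and Newt(g) a hexagon. The polytope contains a region
of height 2 over the left unit interval and one of height 1 over the right one. -/
theorem Shape.vol_ge_of_triangle_left (h : Shape f g x₀ x₁ y₀ y₁ m₀ m₁) (hx : x₁ = x₀ + 2)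
    (hy : y₁ = y₀ + 2) (hm₀ : m₀ = x₀ + y₀) (hm₁ : m₁ = x₀ + y₀ + 2) : 7 / 3 ≤ vol f g := by
  have bf := h.bound_f
  obtain ⟨r, r', hr, fr, fr', gr, gr'⟩ := h.right
  obtain ⟨t, t', ht, ft, ft', gt, gt'⟩ := h.top
  obtain ⟨s, s', hs, fs, fs', gs, gs'⟩ := h.low
  have := bf _ _ fr
  have := bf _ _ fr'
  have := bf _ _ ft
  have := bf _ _ ft'
  have := bf _ _ fs
  have := bf _ _ fs'
  have f00 : f.coeff ![x₀, y₀] ≠ ⊥ := coeff_ne_bot_of_eq fs (by omega) (by omega)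
  have f20 : f.coeff ![x₀ + 2, y₀] ≠ ⊥ := coeff_ne_bot_of_eq fr (by omega) (by omega)
  have f02 : f.coeff ![x₀, y₀ + 2] ≠ ⊥ := coeff_ne_bot_of_eq ft (by omega) (by omega)
  have g01 : g.coeff ![x₀, y₀ + 1] ≠ ⊥ := coeff_ne_bot_of_eq gs (by omega) (by omega)
  have g10 : g.coeff ![x₀ + 1, y₀] ≠ ⊥ := coeff_ne_bot_of_eq gs' (by omega) (by omega)
  have g20 : g.coeff ![x₀ + 2, y₀] ≠ ⊥ := coeff_ne_bot_of_eq gr (by omega) (by omega)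
  have g21 : g.coeff ![x₀ + 2, y₀ + 1] ≠ ⊥ := coeff_ne_bot_of_eq gr' (by omega) (by omega)
  have g02 : g.coeff ![x₀, y₀ + 2] ≠ ⊥ := coeff_ne_bot_of_eq gt (by omega) (by omega)
  have g12 : g.coeff ![x₀ + 1, y₀ + 2] ≠ ⊥ := coeff_ne_bot_of_eq gt' (by omega) (by omega)
  have l10 : ![(x₀ : ℝ) + 1, y₀, 0] ∈ (graphPoly f g).newt :=
    mem_of_eq (lower_step_mem (u := 1) (v := 0) (n := 2) (by norm_num) f00
      (coeff_ne_bot_of_eq f20 (by omega) (by omega))) (by simp) (by simp)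
  have l11 : ![(x₀ : ℝ) + 1, y₀ + 1, 0] ∈ (graphPoly f g).newt :=
    mem_of_eq (lower_step_mem (u := 1) (v := -1) (n := 2) (by norm_num) f02
      (coeff_ne_bot_of_eq f20 (by omega) (by omega))) (by simp) (by push_cast; ring)
  have u11 : ![(x₀ : ℝ) + 1, y₀ + 1, 1] ∈ (graphPoly f g).newt :=
    mem_of_eq (upper_step_mem (u := 1) (v := -1) (n := 2) (by norm_num) g02
      (coeff_ne_bot_of_eq g20 (by omega) (by omega))) (by simp) (by push_cast; ring)
  refine le_vol_of_two_slabs (a₀ := x₀) (a₁ := y₀) (b₀ := x₀ + 1) (b₁ := y₀) (by simp)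
    (slab_translate_mem (convex_newt _) _ _ ?_ ?_ ?_ ?_ ?_ ?_ ?_ ?_)
    (slab_translate_mem (convex_newt _) _ _ ?_ ?_ ?_ ?_ ?_ ?_ ?_ ?_)
  · exact lower_mem_newt f00
  · exact mem_of_eq (upper_mem_newt g01) (by simp) (by simp)
  · exact mem_of_eq (upper_mem_newt g10) (by simp) (by simp)
  · exact l10
  · exact mem_of_eq (lower_mem_newt f02) (by simp) (by simp)
  · exact mem_of_eq (upper_mem_newt g02) (by simp) (by simp)
  · exact mem_of_eq (upper_mem_newt g12) (by simp) (by simp)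
  · exact mem_of_eq l11 (by simp) (by norm_num)
  · exact l10
  · exact u11
  · exact mem_of_eq (upper_mem_newt g20) (by push_cast; ring) (by simp)
  · exact mem_of_eq (lower_mem_newt f20) (by push_cast; ring) (by simp)
  · exact l11
  · exact u11
  · exact mem_of_eq (upper_mem_newt g21) (by push_cast; ring) (by simp)
  · exact mem_of_eq (lower_mem_newt f20) (by push_cast; ring) (by simp)

/-- The opposite situation: Newt(g) is the triangle and Newt(f) the hexagon, and the region of
height 2 lies over the right interval. -/
theorem Shape.vol_ge_of_triangle_right (h : Shape f g x₀ x₁ y₀ y₁ m₀ m₁) (hx : x₁ = x₀ + 2)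
    (hy : y₁ = y₀ + 2) (hm₀ : m₀ = x₀ + y₀ + 1) (hm₁ : m₁ = x₀ + y₀ + 3) :
    7 / 3 ≤ vol f g := by
  have bf := h.bound_f
  obtain ⟨l, l', hl, fl, fl', gl, -⟩ := h.left
  obtain ⟨p, p', hp, fp, fp', gp, -⟩ := h.bottom
  obtain ⟨s, s', hs, fs, fs', gs, -⟩ := h.high
  have := bf _ _ fl
  have := bf _ _ fl'
  have := bf _ _ fp
  have := bf _ _ fp'
  have := bf _ _ fs
  have := bf _ _ fs'
  have f10 : f.coeff ![x₀ + 1, y₀] ≠ ⊥ := coeff_ne_bot_of_eq fp (by omega) (by omega)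
  have f20 : f.coeff ![x₀ + 2, y₀] ≠ ⊥ := coeff_ne_bot_of_eq fp' (by omega) (by omega)
  have f01 : f.coeff ![x₀, y₀ + 1] ≠ ⊥ := coeff_ne_bot_of_eq fl (by omega) (by omega)
  have f02 : f.coeff ![x₀, y₀ + 2] ≠ ⊥ := coeff_ne_bot_of_eq fl' (by omega) (by omega)
  have f12 : f.coeff ![x₀ + 1, y₀ + 2] ≠ ⊥ := coeff_ne_bot_of_eq fs (by omega) (by omega)
  have f21 : f.coeff ![x₀ + 2, y₀ + 1] ≠ ⊥ := coeff_ne_bot_of_eq fs' (by omega) (by omega)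
  have g22 : g.coeff ![x₀ + 2, y₀ + 2] ≠ ⊥ := coeff_ne_bot_of_eq gs (by omega) (by omega)
  have g02 : g.coeff ![x₀, y₀ + 2] ≠ ⊥ := coeff_ne_bot_of_eq gl (by omega) (by omega)
  have g20 : g.coeff ![x₀ + 2, y₀] ≠ ⊥ := coeff_ne_bot_of_eq gp (by omega) (by omega)
  have l11 : ![(x₀ : ℝ) + 1, y₀ + 1, 0] ∈ (graphPoly f g).newt :=
    mem_of_eq (lower_step_mem (u := 1) (v := -1) (n := 2) (by norm_num) f02
      (coeff_ne_bot_of_eq f20 (by omega) (by omega))) (by simp) (by push_cast; ring)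
  have u11 : ![(x₀ : ℝ) + 1, y₀ + 1, 1] ∈ (graphPoly f g).newt :=
    mem_of_eq (upper_step_mem (u := 1) (v := -1) (n := 2) (by norm_num) g02
      (coeff_ne_bot_of_eq g20 (by omega) (by omega))) (by simp) (by push_cast; ring)
  have u12 : ![(x₀ : ℝ) + 1, y₀ + 2, 1] ∈ (graphPoly f g).newt :=
    mem_of_eq (upper_step_mem (u := 1) (v := 0) (n := 2) (by norm_num) g02
      (coeff_ne_bot_of_eq g22 (by omega) (by omega))) (by simp) (by simp)
  refine le_vol_of_two_slabs (a₀ := x₀ + 1) (a₁ := y₀) (b₀ := x₀) (b₁ := y₀ + 1) (by simp)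
    (slab_translate_mem (convex_newt _) _ _ ?_ ?_ ?_ ?_ ?_ ?_ ?_ ?_)
    (slab_translate_mem (convex_newt _) _ _ ?_ ?_ ?_ ?_ ?_ ?_ ?_ ?_)
  · exact mem_of_eq (lower_mem_newt f10) (by simp) (by simp)
  · exact u11
  · exact mem_of_eq (upper_mem_newt g20) (by push_cast; ring) (by simp)
  · exact mem_of_eq (lower_mem_newt f20) (by push_cast; ring) (by simp)
  · exact mem_of_eq (lower_mem_newt f12) (by simp) (by simp)
  · exact u12
  · exact mem_of_eq (upper_mem_newt g22) (by push_cast; ring) (by simp)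
  · exact mem_of_eq (lower_mem_newt f21) (by push_cast; ring) (by push_cast; ring)
  · exact mem_of_eq (lower_mem_newt f01) (by simp) (by simp)
  · exact mem_of_eq (upper_mem_newt g02) (by simp) (by push_cast; ring)
  · exact u11
  · exact l11
  · exact mem_of_eq (lower_mem_newt f02) (by simp) (by push_cast; ring)
  · exact mem_of_eq (upper_mem_newt g02) (by simp) (by push_cast; ring)
  · exact mem_of_eq u12 rfl (by ring)
  · exact mem_of_eq l11 rfl (by ring)

/-- A pair of small volume is of one of three shapes; the first of them is impossible. -/
theorem Expresses.small_cases (h : Expresses f g) (hv : vol f g < 11 / 6) :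
    (∃ x₀ x₁ y₀ m₀ m₁, Shape f g x₀ x₁ y₀ (y₀ + 1) m₀ m₁) ∨
      (∃ a b, FirstSupport f g a b) ∨ ∃ a b, SecondSupport f g a b := by
  obtain ⟨x₀, x₁, y₀, y₁, m₀, m₁, hs⟩ := h.exists_shape
  -- Width 3 would give volume at least 2. Any bound up to 2 would do in place of 11/6, since the
  -- other shapes excluded by volume have at least 7/3.
  have small : ∀ p q : ℤ, 2 / 3 * ((p : ℝ) - q) ≤ vol f g → p ≤ q + 2 := by
    intro p q hpq
    by_contra hlt
    have : q + 3 ≤ p := by omega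
    have : (q : ℝ) + 3 ≤ p := by exact_mod_cast this
    linarith
  have hx := small _ _ hs.vol_ge_x
  have hy := small _ _ hs.vol_ge_y
  have hm := small _ _ hs.vol_ge_m
  have bf := hs.bound_f
  obtain ⟨l, l', hl, fl, fl', -, -⟩ := hs.left
  obtain ⟨p, p', hp, fp, fp', -, -⟩ := hs.bottom
  obtain ⟨t, -, -, ft, -, -, -⟩ := hs.top
  obtain ⟨r, -, -, fr, -, -, -⟩ := hs.right
  obtain ⟨s, -, -, fs, -, -, -⟩ := hs.low
  have := bf _ _ fl
  have := bf _ _ fl'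
  have := bf _ _ fp
  have := bf _ _ fp'
  have := bf _ _ ft
  have := bf _ _ fr
  have := bf _ _ fs
  rcases (by omega : y₁ = y₀ + 1 ∨ y₁ = y₀ + 2) with rfl | hy'
  · exact Or.inl ⟨_, _, _, _, _, hs⟩
  · rcases (by omega : x₁ = x₀ + 1 ∨ x₁ = x₀ + 2) with hx' | hx'
    · exact Or.inr (Or.inl ⟨_, _, hs.firstSupport hx'.le hy' hm⟩)
    -- The left edge of f, of length at least 1, gives m₀ ≤ x₀ + y₀ + 1, and its point on the right
    -- side gives m₁ ≥ x₀ + y₀ + 2; with m₁ ≤ m₀ + 2 three cases remain.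
    · rcases (by omega : (m₀ = x₀ + y₀ ∧ m₁ = x₀ + y₀ + 2) ∨
        (m₀ = x₀ + y₀ + 1 ∧ m₁ = x₀ + y₀ + 2) ∨ (m₀ = x₀ + y₀ + 1 ∧ m₁ = x₀ + y₀ + 3)) with
        ⟨h0, h1⟩ | ⟨h0, h1⟩ | ⟨h0, h1⟩
      · have := hs.vol_ge_of_triangle_left hx' hy' h0 h1
        linarith
      · exact Or.inr (Or.inr ⟨_, _, hs.secondSupport hx' hy' h0 h1⟩)
      · have := hs.vol_ge_of_triangle_right hx' hy' h0 h1
        linarith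

end Hexagons

end TropPoly

namespace TropPoly

/-! ### Quotients of degree one in one variable -/

section OneVariable

/-- A quotient of two tropical polynomials of degree one determines the ratios of outer
coefficients, and the roots if they do not cancel. -/
theorem linear_quot_unique {A B C D A' B' C' D' : ℝ}
    (h : ∀ s, max A (s + B) - max C (s + D) = max A' (s + B') - max C' (s + D')) :
    A - C = A' - C' ∧ B - D = B' - D' ∧ (A' - B' ≠ C' - D' → A - B = A' - B') := by
  have h1 : A - C = A' - C' := by
    obtain ⟨s, hs1, hs2, hs3, hs4⟩ : ∃ s, s ≤ A - B ∧ s ≤ C - D ∧ s ≤ A' - B' ∧ s ≤ C' - D' :=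
      ⟨min (min (A - B) (C - D)) (min (A' - B') (C' - D')), by simp, by simp, by simp, by simp⟩
    have := h s
    rwa [max_eq_left (by linarith), max_eq_left (by linarith), max_eq_left (by linarith),
      max_eq_left (by linarith)] at this
  have h2 : B - D = B' - D' := by
    obtain ⟨s, hs1, hs2, hs3, hs4⟩ : ∃ s, A - B ≤ s ∧ C - D ≤ s ∧ A' - B' ≤ s ∧ C' - D' ≤ s :=
      ⟨max (max (A - B) (C - D)) (max (A' - B') (C' - D')), by simp, by simp, by simp, by simp⟩
    have := h s
    rw [max_eq_right (by linarith), max_eq_right (by linarith), max_eq_right (by linarith),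
      max_eq_right (by linarith)] at this
    linarith
  refine ⟨h1, h2, fun hne => ?_⟩
  have key : ∀ s, max (A - B) s - max (C - D) s = max (A' - B') s - max (C' - D') s := by
    intro s
    have e : ∀ P Q : ℝ, max P (s + Q) = Q + max (P - Q) s := by
      intro P Q
      rw [← max_add_add_left]
      ring_nf
    have := h s
    rw [e, e, e, e] at this
    linarith
  -- Both sides can break only at the four roots; their values there decide.
  have k1 := key (A - B)
  have k2 := key (A' - B')
  have k3 := key (C - D)
  have k4 := key (C' - D')
  rcases lt_or_gt_of_ne hne with hlt | hlt <;> grind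

end OneVariable

/-! ### Determination of the coefficients -/

section Solve

/-- On lines parallel to the axes `phi` is a quotient of degree one. For x < 0 the numerator has
root 0 and the denominator root x; for x > 0 the roots are 1 + x and 1. -/
theorem phi_eq_of_left_neg {x : ℝ} (hx : x < 0) (s : ℝ) :
    phi x s = max 0 (s + 0) - max x (s + 0) := by
  rw [phi]
  grind

theorem phi_eq_of_left_pos {x : ℝ} (hx : 0 < x) (s : ℝ) :
    phi x s = max (1 + x) (s + 0) - max (1 + x) (s + x) := by
  rw [phi]
  grind

theorem phi_eq_of_right_neg {y : ℝ} (hy : y < 0) (s : ℝ) :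
    phi s y = max 0 (s + 0) - max y (s + 0) := by
  rw [phi]
  grind

theorem phi_eq_of_right_gt {y : ℝ} (hy : 1 < y) (s : ℝ) :
    phi s y = max (y - 1) (s + 0) - max (y - 1) (s + (y - 1)) := by
  rw [phi]
  grind

/-- Here the roots cancel, so only the equality of corresponding coefficients of numerator and
denominator can be inferred. -/
theorem phi_eq_of_right_mem {y : ℝ} (hy : 0 ≤ y) (hy' : y ≤ 1) (s : ℝ) :
    phi s y = max 0 (s + 0) - max 0 (s + 0) := by
  rw [phi]
  grind

/-- The summand s compensates for g₂ starting one degree above f₂. The roots -max(v, 0) and max(1 -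
v, 0) never coincide, so no v has to be excluded. -/
theorem phi_diagonal (v s : ℝ) : phi s (s + v) + s =
    max 0 (s + max v 0) - max (max v 0) (s + (max v 0 - max (1 - v) 0)) := by
  rw [phi]
  rcases le_total v 0 with h | h
  · rw [max_eq_right h, max_eq_left (by linarith : (0 : ℝ) ≤ 1 - v)]
    grind
  rcases le_total v 1 with h' | h'
  · rw [max_eq_left h, max_eq_left (by linarith : (0 : ℝ) ≤ 1 - v)]
    grind
  · rw [max_eq_left h, max_eq_right (by linarith : 1 - v ≤ 0)]
    grind

/-- The outer terms stay below the maximum, so the middle one attains it. This detects the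
coefficient at the midpoint of an edge. -/
theorem eq_of_max_eq {a b m : ℝ} (hb : b = a) (h : max (max a (m + 1 / 2)) b = a + 1 / 2) :
    m = a := by
  subst hb
  rcases max_cases b (m + 1 / 2) with ⟨e, -⟩ | ⟨e, -⟩ <;> rw [e] at h
  · rw [max_self] at h
    linarith
  · rcases max_cases (m + 1 / 2) b with ⟨e, -⟩ | ⟨e, -⟩ <;> linarith

/-- For fixed y both polynomials have degree one in x, with coefficients `A`, `B` and `C`, `D`.
Values at large |y| give the relations among the outer coefficients, the breakpoint of `B` relates
their two levels, and y = 1/2 gives the middle ones. -/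
theorem solve_first {c00 c10 c11 c02 c01 d10 d01 d02 d12 d11 : ℝ}
    (h : ∀ x y : ℝ, max (max (max c00 (c01 + y)) (c02 + 2 * y)) (x + max c10 (c11 + y)) -
      max (max (d01 + y) (d02 + 2 * y)) (x + max (max d10 (d11 + y)) (d12 + 2 * y)) = phi x y) :
    c10 = c00 ∧ c11 = c00 ∧ c01 = c00 ∧ c02 = c00 - 1 ∧ d10 = c00 ∧ d01 = c00 ∧ d11 = c00 ∧
      d12 = c00 - 1 ∧ d02 = c00 - 1 := by
  set A : ℝ → ℝ := fun y => max (max c00 (c01 + y)) (c02 + 2 * y) with hA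
  set B : ℝ → ℝ := fun y => max c10 (c11 + y) with hB
  set C : ℝ → ℝ := fun y => max (d01 + y) (d02 + 2 * y) with hC
  set D : ℝ → ℝ := fun y => max (max d10 (d11 + y)) (d12 + 2 * y) with hD
  have neg : ∀ y < 0, A y - C y = -y ∧ B y = D y ∧ A y = B y := by
    intro y hy
    obtain ⟨h1, h2, h3⟩ := linear_quot_unique fun s =>
      (h s y).trans (phi_eq_of_right_neg hy s)
    have h3 := h3 (by linarith)
    exact ⟨by linarith, by linarith, by linarith⟩
  have pos : ∀ y > 1, A y = C y ∧ B y - D y = 1 - y ∧ A y - B y = y - 1 := by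
    intro y hy
    obtain ⟨h1, h2, h3⟩ := linear_quot_unique fun s =>
      (h s y).trans (phi_eq_of_right_gt hy s)
    have h3 := h3 (by linarith)
    exact ⟨by linarith, by linarith, by linarith⟩
  obtain ⟨mid1, mid2, -⟩ := linear_quot_unique fun s =>
    (h s (1 / 2)).trans (phi_eq_of_right_mem (by norm_num) (by norm_num) s)
  -- Coefficients differ by at most 2 S, so at y = ±(2 S + 2) the term of extreme degree attains
  -- each maximum.
  obtain ⟨S, hS⟩ : ∃ S, S = |c00| + |c10| + |c11| + |c02| + |c01| + |d10| + |d01| + |d02| +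
    |d12| + |d11| := ⟨_, rfl⟩
  have b1 := abs_nonneg c00
  have b2 := abs_nonneg c10
  have b3 := abs_nonneg c11
  have b4 := abs_nonneg c02
  have b5 := abs_nonneg c01
  have b6 := abs_nonneg d10
  have b7 := abs_nonneg d01
  have b8 := abs_nonneg d02
  have b9 := abs_nonneg d12
  have b10 := abs_nonneg d11
  have bd : ∀ p : ℝ, |p| ≤ S → -S ≤ p ∧ p ≤ S := fun p hp => abs_le.1 hp
  obtain ⟨l1, u1⟩ := bd c00 (by linarith)
  obtain ⟨l2, u2⟩ := bd c10 (by linarith)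
  obtain ⟨l3, u3⟩ := bd c11 (by linarith)
  obtain ⟨l4, u4⟩ := bd c02 (by linarith)
  obtain ⟨l5, u5⟩ := bd c01 (by linarith)
  obtain ⟨l6, u6⟩ := bd d10 (by linarith)
  obtain ⟨l7, u7⟩ := bd d01 (by linarith)
  obtain ⟨l8, u8⟩ := bd d02 (by linarith)
  obtain ⟨l9, u9⟩ := bd d12 (by linarith)
  obtain ⟨l10, u10⟩ := bd d11 (by linarith)
  have hS0 : 0 ≤ S := by linarith
  obtain ⟨n1, n2, n3⟩ := neg (-(2 * S + 2)) (by linarith)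
  obtain ⟨p1, p2, p3⟩ := pos (2 * S + 2) (by linarith)
  have eA : A (-(2 * S + 2)) = c00 := by
    rw [hA]
    simp only
    rw [max_eq_left, max_eq_left] <;> linarith [le_max_left c00 (c01 + -(2 * S + 2))]
  have eB : B (-(2 * S + 2)) = c10 := max_eq_left (by linarith)
  have eC : C (-(2 * S + 2)) = d01 + -(2 * S + 2) := max_eq_left (by linarith)
  have eD : D (-(2 * S + 2)) = d10 := by
    rw [hD]
    simp only
    rw [max_eq_left, max_eq_left] <;> linarith [le_max_left d10 (d11 + -(2 * S + 2))]
  have eA' : A (2 * S + 2) = c02 + 2 * (2 * S + 2) :=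
    max_eq_right (max_le (by linarith) (by linarith))
  have eB' : B (2 * S + 2) = c11 + (2 * S + 2) := max_eq_right (by linarith)
  have eC' : C (2 * S + 2) = d02 + 2 * (2 * S + 2) := max_eq_right (by linarith)
  have eD' : D (2 * S + 2) = d12 + 2 * (2 * S + 2) :=
    max_eq_right (max_le (by linarith) (by linarith))
  rw [eA, eC] at n1
  rw [eB, eD] at n2
  rw [eA, eB] at n3
  rw [eA', eC'] at p1
  rw [eB', eD'] at p2
  rw [eA', eB'] at p3
  obtain rfl : c10 = c00 := by linarith
  obtain rfl : d10 = c10 := by linarith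
  obtain rfl : d01 = d10 := by linarith
  obtain rfl : d02 = c02 := by linarith
  obtain rfl : d12 = d02 := by linarith
  obtain rfl : c11 = d12 + 1 := by linarith
  -- The breakpoint d01 - d12 - 1 of `B` has to be 0. Were it negative, the identities for y < 0
  -- would fail at half of it; were it positive, those for y > 1 would fail at 1 plus half of it.
  have hle : d12 + 1 ≤ d01 := by
    by_contra hlt
    push Not at hlt
    obtain ⟨q1, -, q3⟩ := neg (-((d12 + 1 - d01) / 2)) (by linarith)
    have hC' : C (-((d12 + 1 - d01) / 2)) < d01 := max_lt (by linarith) (by linarith)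
    have hB' : d12 + 1 + -((d12 + 1 - d01) / 2) ≤ B (-((d12 + 1 - d01) / 2)) :=
      le_max_right _ _
    linarith
  have hge : d01 ≤ d12 + 1 := by
    by_contra hlt
    push Not at hlt
    obtain ⟨q1, -, q3⟩ := pos (1 + (d01 - d12 - 1) / 2) (by linarith)
    have hC' : d01 + (1 + (d01 - d12 - 1) / 2) ≤ C (1 + (d01 - d12 - 1) / 2) :=
      le_max_left _ _
    have hB' : B (1 + (d01 - d12 - 1) / 2) < d01 + 1 := max_lt (by linarith) (by linarith)
    linarith
  obtain rfl : d01 = d12 + 1 := le_antisymm hge hle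
  have hc : c01 = d12 + 1 := by
    refine eq_of_max_eq (b := d12 + 2 * (1 / 2)) (by ring) ?_
    rw [max_eq_left (by linarith : d12 + 2 * (1 / 2) ≤ d12 + 1 + 1 / 2)] at mid1
    linarith
  have hd : d11 = d12 + 1 := by
    refine eq_of_max_eq (b := d12 + 2 * (1 / 2)) (by ring) ?_
    rw [max_eq_right (by linarith : d12 + 1 ≤ d12 + 1 + 1 / 2)] at mid2
    linarith
  refine ⟨rfl, rfl, hc, by ring, rfl, rfl, hd, by ring, by ring⟩

/-- The same method on the lines y = x + v, grouped by total degree. All three identities now hold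
for every v, so the values at 0, 1 and 1/2 complete those at infinity. -/
theorem solve_second {c20 c11 c02 c10 c01 d21 d12 d20 d11 d02 : ℝ}
    (h : ∀ x v : ℝ, max (max c10 (c01 + v)) (x + max (max c20 (c11 + v)) (c02 + 2 * v)) -
      max (max (max d20 (d11 + v)) (d02 + 2 * v)) (x + max (d21 + v) (d12 + 2 * v)) =
        phi x (x + v) + x) :
    c11 = c20 ∧ c02 = c20 - 1 ∧ c10 = c20 ∧ c01 = c20 - 1 ∧ d21 = c20 - 1 ∧ d12 = c20 - 1 ∧
      d20 = c20 ∧ d11 = c20 ∧ d02 = c20 - 1 := by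
  set A : ℝ → ℝ := fun v => max c10 (c01 + v) with hA
  set B : ℝ → ℝ := fun v => max (max c20 (c11 + v)) (c02 + 2 * v) with hB
  set C : ℝ → ℝ := fun v => max (max d20 (d11 + v)) (d02 + 2 * v) with hC
  set D : ℝ → ℝ := fun v => max (d21 + v) (d12 + 2 * v) with hD
  have key : ∀ v, A v - C v = -max v 0 ∧ B v - D v = max (1 - v) 0 ∧ A v - B v = -max v 0 := by
    intro v
    obtain ⟨h1, h2, h3⟩ := linear_quot_unique fun s => (h s v).trans (phi_diagonal v s)
    have h3 := h3 (by grind)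
    exact ⟨by linarith, by linarith, by linarith⟩
  obtain ⟨S, hS⟩ : ∃ S, S = |c20| + |c11| + |c02| + |c10| + |c01| + |d21| + |d12| + |d20| +
    |d11| + |d02| := ⟨_, rfl⟩
  have b1 := abs_nonneg c20
  have b2 := abs_nonneg c11
  have b3 := abs_nonneg c02
  have b4 := abs_nonneg c10
  have b5 := abs_nonneg c01
  have b6 := abs_nonneg d21
  have b7 := abs_nonneg d12
  have b8 := abs_nonneg d20
  have b9 := abs_nonneg d11
  have b10 := abs_nonneg d02
  have bd : ∀ p : ℝ, |p| ≤ S → -S ≤ p ∧ p ≤ S := fun p hp => abs_le.1 hp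
  obtain ⟨l1, u1⟩ := bd c20 (by linarith)
  obtain ⟨l2, u2⟩ := bd c11 (by linarith)
  obtain ⟨l3, u3⟩ := bd c02 (by linarith)
  obtain ⟨l4, u4⟩ := bd c10 (by linarith)
  obtain ⟨l5, u5⟩ := bd c01 (by linarith)
  obtain ⟨l6, u6⟩ := bd d21 (by linarith)
  obtain ⟨l7, u7⟩ := bd d12 (by linarith)
  obtain ⟨l8, u8⟩ := bd d20 (by linarith)
  obtain ⟨l9, u9⟩ := bd d11 (by linarith)
  obtain ⟨l10, u10⟩ := bd d02 (by linarith)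
  have hS0 : 0 ≤ S := by linarith
  obtain ⟨n1, n2, n3⟩ := key (-(2 * S + 2))
  obtain ⟨p1, p2, p3⟩ := key (2 * S + 2)
  rw [max_eq_right (by linarith : -(2 * S + 2) ≤ 0)] at n1 n3
  rw [max_eq_left (by linarith : 0 ≤ 1 - -(2 * S + 2))] at n2
  rw [max_eq_left (by linarith : 0 ≤ 2 * S + 2)] at p1 p3
  rw [max_eq_right (by linarith : 1 - (2 * S + 2) ≤ 0)] at p2
  have eA : A (-(2 * S + 2)) = c10 := max_eq_left (by linarith)
  have eB : B (-(2 * S + 2)) = c20 := by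
    rw [hB]
    simp only
    rw [max_eq_left, max_eq_left] <;> linarith [le_max_left c20 (c11 + -(2 * S + 2))]
  have eC : C (-(2 * S + 2)) = d20 := by
    rw [hC]
    simp only
    rw [max_eq_left, max_eq_left] <;> linarith [le_max_left d20 (d11 + -(2 * S + 2))]
  have eD : D (-(2 * S + 2)) = d21 + -(2 * S + 2) := max_eq_left (by linarith)
  have eA' : A (2 * S + 2) = c01 + (2 * S + 2) := max_eq_right (by linarith)
  have eB' : B (2 * S + 2) = c02 + 2 * (2 * S + 2) :=
    max_eq_right (max_le (by linarith) (by linarith))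
  have eC' : C (2 * S + 2) = d02 + 2 * (2 * S + 2) :=
    max_eq_right (max_le (by linarith) (by linarith))
  have eD' : D (2 * S + 2) = d12 + 2 * (2 * S + 2) := max_eq_right (by linarith)
  rw [eA, eC] at n1
  rw [eB, eD] at n2
  rw [eA, eB] at n3
  rw [eA', eC'] at p1
  rw [eB', eD'] at p2
  rw [eA', eB'] at p3
  obtain rfl : c10 = c20 := by linarith
  obtain rfl : d20 = c10 := by linarith
  obtain rfl : d21 = d20 - 1 := by linarith
  obtain rfl : c01 = c02 := by linarith
  obtain rfl : d02 = c01 := by linarith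
  obtain rfl : d12 = d02 := by linarith
  obtain ⟨-, q2, q3⟩ := key 0
  obtain ⟨-, r2, r3⟩ := key 1
  obtain ⟨m1, -, m3⟩ := key (1 / 2)
  rw [max_self] at q3
  rw [sub_zero, max_eq_left zero_le_one] at q2
  rw [max_eq_left zero_le_one] at r3
  rw [sub_self, max_self] at r2
  rw [max_eq_left (by norm_num : (0 : ℝ) ≤ 1 / 2)] at m1 m3
  have hle : d12 ≤ d20 - 1 := by
    have h1 : d12 + 2 * 0 ≤ D 0 := le_max_right _ _
    have h2 : A 0 = max d20 (d12 + 0) := rfl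
    rcases max_cases d20 (d12 + 0) with ⟨e, -⟩ | ⟨e, -⟩ <;> linarith
  have hge : d20 - 1 ≤ d12 := by
    have h1 : d20 ≤ A 1 := le_max_left _ _
    have h2 : D 1 = max (d20 - 1 + 1) (d12 + 2 * 1) := rfl
    rcases max_cases (d20 - 1 + 1) (d12 + 2 * 1) with ⟨e, -⟩ | ⟨e, -⟩ <;> linarith
  obtain rfl : d12 = d20 - 1 := le_antisymm hle hge
  have eM : A (1 / 2) = d20 := max_eq_left (by linarith)
  have hc : c11 = d20 := by
    refine eq_of_max_eq (b := d20 - 1 + 2 * (1 / 2)) (by ring) ?_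
    change B (1 / 2) = _
    linarith
  have hd : d11 = d20 := by
    refine eq_of_max_eq (b := d20 - 1 + 2 * (1 / 2)) (by ring) ?_
    change C (1 / 2) = _
    linarith
  exact ⟨hc, rfl, rfl, rfl, rfl, rfl, rfl, hd, rfl⟩

end Solve

end TropPoly

namespace TropPoly

/-! ### Impossibility of width one in y -/

section Rows

/-- The row of `f` with second exponent `b`. -/
noncomputable def row (f : TropPoly 2) (b : ℤ) : Finset (Fin 2 → ℤ) :=
  f.support.filter fun i => i 1 = b

theorem mem_row {f : TropPoly 2} {b : ℤ} {i : Fin 2 → ℤ} :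
    i ∈ f.row b ↔ f.coeff i ≠ ⊥ ∧ i 1 = b := by
  simp [row, mem_support]

/-- A polynomial with two consecutive rows is, in the second variable, of degree one with
continuous coefficients. -/
theorem exists_rows {f : TropPoly 2} {b : ℤ}
    (hb : ∀ i j, f.coeff ![i, j] ≠ ⊥ → b ≤ j ∧ j ≤ b + 1)
    (h0 : ∃ i, f.coeff ![i, b] ≠ ⊥) (h1 : ∃ i, f.coeff ![i, b + 1] ≠ ⊥) :
    ∃ A B : ℝ → ℝ, Continuous A ∧ Continuous B ∧
      ∀ x y, f.evalReal ![x, y] = b * y + max (A x) (y + B x) := by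
  obtain ⟨i0, h0⟩ := h0
  obtain ⟨i1, h1⟩ := h1
  have n0 : (f.row b).Nonempty := ⟨_, mem_row.2 ⟨h0, rfl⟩⟩
  have n1 : (f.row (b + 1)).Nonempty := ⟨_, mem_row.2 ⟨h1, rfl⟩⟩
  refine ⟨fun x => (f.row b).sup' n0 fun i => f.realCoeff i + i 0 * x,
    fun x => (f.row (b + 1)).sup' n1 fun i => f.realCoeff i + i 0 * x,
    Continuous.finset_sup'_apply n0 fun i _ => by fun_prop,
    Continuous.finset_sup'_apply n1 fun i _ => by fun_prop, fun x y => ?_⟩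
  beta_reduce
  refine evalReal_eq_of_le ?_ fun i hi => ?_
  · obtain ⟨j0, m0, e0⟩ := Finset.exists_mem_eq_sup' n0 fun i => f.realCoeff i + i 0 * x
    obtain ⟨j1, m1, e1⟩ := Finset.exists_mem_eq_sup' n1 fun i => f.realCoeff i + i 0 * x
    rw [mem_row] at m0 m1
    rw [e0, e1]
    rcases max_cases (f.realCoeff j0 + j0 0 * x) (y + (f.realCoeff j1 + j1 0 * x)) with
      ⟨e, -⟩ | ⟨e, -⟩
    · refine ⟨j0, m0.1, ?_⟩
      rw [e, pair_two, m0.2]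
      linarith
    · refine ⟨j1, m1.1, ?_⟩
      rw [e, pair_two, m1.2]
      push_cast
      linarith
  · have hb' := hb (i 0) (i 1) (by rwa [vec_eta])
    rw [pair_two]
    rcases (by omega : i 1 = b ∨ i 1 = b + 1) with e | e
    · have := Finset.le_sup' (fun i => f.realCoeff i + i 0 * x) (mem_row.2 ⟨hi, e⟩)
      rw [e]
      have := this.trans (le_max_left _ (y + (f.row (b + 1)).sup' n1
        fun i => f.realCoeff i + i 0 * x))
      linarith
    · have := Finset.le_sup' (fun i => f.realCoeff i + i 0 * x) (mem_row.2 ⟨hi, e⟩)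
      rw [e]
      have := (add_le_add_right this y).trans (le_max_right ((f.row b).sup' n0
        fun i => f.realCoeff i + i 0 * x) _)
      push_cast
      linarith

/-- The root `A x - B x` of f in y is continuous in x, but `phi` requires it to be 0 for x < 0 and 1
+ x for x > 0. -/
theorem Expresses.not_two_rows {f g : TropPoly 2} (h : Expresses f g) {x₀ x₁ y₀ m₀ m₁ : ℤ}
    (hs : Shape f g x₀ x₁ y₀ (y₀ + 1) m₀ m₁) : False := by
  obtain ⟨p, -, -, fp, -, gp, -⟩ := hs.bottom
  obtain ⟨t, -, -, ft, -, gt, -⟩ := hs.top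
  obtain ⟨A, B, hA, hB, hf⟩ := exists_rows
    (fun i j hij => ⟨(hs.bound_f i j hij).2.2.1, (hs.bound_f i j hij).2.2.2.1⟩) ⟨p, fp⟩ ⟨t, ft⟩
  obtain ⟨C, D, -, -, hg⟩ := exists_rows
    (fun i j hij => ⟨(hs.bound_g i j hij).2.2.1, (hs.bound_g i j hij).2.2.2.1⟩)
    ⟨p + 1, gp⟩ ⟨t, gt⟩
  have key : ∀ x s, max (A x) (s + B x) - max (C x) (s + D x) = phi x s := by
    intro x s
    have := h.eval_eq x s
    rw [hf, hg] at this
    linarith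
  have neg : ∀ x ∈ Set.Iio (0 : ℝ), A x - B x = 0 := by
    intro x hx
    rw [Set.mem_Iio] at hx
    have := (linear_quot_unique fun s => (key x s).trans (phi_eq_of_left_neg hx s)).2.2
      (by linarith)
    linarith
  have pos : ∀ x ∈ Set.Ioi (0 : ℝ), A x - B x - x = 1 := by
    intro x hx
    rw [Set.mem_Ioi] at hx
    have := (linear_quot_unique fun s => (key x s).trans (phi_eq_of_left_pos hx s)).2.2
      (by linarith)
    linarith
  have c1 : IsClosed {x | A x - B x = 0} := isClosed_eq (by fun_prop) continuous_const
  have c2 : IsClosed {x | A x - B x - x = 1} := isClosed_eq (by fun_prop) continuous_const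
  have e1 : A 0 - B 0 = 0 :=
    c1.closure_subset_iff.2 neg (by rw [closure_Iio]; exact Set.self_mem_Iic)
  have e2 : A 0 - B 0 - 0 = 1 :=
    c2.closure_subset_iff.2 pos (by rw [closure_Ioi]; exact Set.self_mem_Ici)
  linarith

end Rows

/-! ### From the supports to the explicit pairs -/

section Identification

theorem max_five_comm (p q r s t : ℝ) :
    max (max (max (max p q) r) s) t = max (max (max r t) s) (max p q) := by
  ac_rfl

theorem max_five_comm' (p q r s t : ℝ) :
    max (max (max (max p q) r) s) t = max (max p q) (max (max r t) s) := by
  ac_rfl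

/-- The exponent `k` is the midpoint of `k₃` and `k₄`. If it is absent, a term with the average
coefficient can be added without changing the function; the disjunction records this so that it can
be refuted once the coefficients are known. -/
theorem evalReal_eq_max_five {f : TropPoly 2} {k₁ k₂ k₃ k₄ k : Fin 2 → ℤ}
    (h₁ : f.coeff k₁ ≠ ⊥) (h₂ : f.coeff k₂ ≠ ⊥) (h₃ : f.coeff k₃ ≠ ⊥) (h₄ : f.coeff k₄ ≠ ⊥)
    (hs : ∀ i, f.coeff i ≠ ⊥ → i = k₁ ∨ i = k₂ ∨ i = k₃ ∨ i = k₄ ∨ i = k)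
    (hk : ∀ t, 2 * pair k t = pair k₃ t + pair k₄ t) :
    ∃ c : ℝ, (f.coeff k = c ∨ 2 * c = f.realCoeff k₃ + f.realCoeff k₄) ∧ ∀ t,
      f.evalReal t = max (max (max (max (f.realCoeff k₁ + pair k₁ t) (f.realCoeff k₂ + pair k₂ t))
        (f.realCoeff k₃ + pair k₃ t)) (f.realCoeff k₄ + pair k₄ t)) (c + pair k t) := by
  by_cases hb : f.coeff k = ⊥
  · refine ⟨(f.realCoeff k₃ + f.realCoeff k₄) / 2, Or.inr (by ring), fun t => ?_⟩
    have hk := hk t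
    have e : ∀ a b c d m : ℝ, 2 * m = c + d → max (max (max (max a b) c) d) m =
        max (max (max a b) c) d := by
      intro a b c d m hm
      refine max_eq_left ?_
      rcases le_total c d with hcd | hcd
      · exact le_max_of_le_right (by linarith)
      · exact le_max_of_le_left (le_max_of_le_right (by linarith))
    rw [e _ _ _ _ _ (by linarith)]
    refine evalReal_eq_of_le ?_ fun i hi => ?_
    · set a := f.realCoeff k₁ + pair k₁ t with ha
      set b := f.realCoeff k₂ + pair k₂ t
      set c := f.realCoeff k₃ + pair k₃ t
      set d := f.realCoeff k₄ + pair k₄ t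
      rcases (by grind : max (max (max a b) c) d = a ∨ max (max (max a b) c) d = b ∨
        max (max (max a b) c) d = c ∨ max (max (max a b) c) d = d) with e | e | e | e
      · exact ⟨k₁, h₁, e.le⟩
      · exact ⟨k₂, h₂, e.le⟩
      · exact ⟨k₃, h₃, e.le⟩
      · exact ⟨k₄, h₄, e.le⟩
    · rcases hs i hi with rfl | rfl | rfl | rfl | rfl
      · simp
      · simp
      · simp
      · simp
      · exact absurd hb hi
  · refine ⟨f.realCoeff k, Or.inl (coe_realCoeff hb).symm, fun t => ?_⟩
    refine evalReal_eq_of_le ?_ fun i hi => ?_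
    · set a := f.realCoeff k₁ + pair k₁ t
      set b := f.realCoeff k₂ + pair k₂ t
      set c := f.realCoeff k₃ + pair k₃ t
      set d := f.realCoeff k₄ + pair k₄ t
      set m := f.realCoeff k + pair k t
      rcases (by grind : max (max (max (max a b) c) d) m = a ∨ max (max (max (max a b) c) d) m = b ∨
        max (max (max (max a b) c) d) m = c ∨ max (max (max (max a b) c) d) m = d ∨
        max (max (max (max a b) c) d) m = m) with e | e | e | e | e
      · exact ⟨k₁, h₁, e.le⟩
      · exact ⟨k₂, h₂, e.le⟩
      · exact ⟨k₃, h₃, e.le⟩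
      · exact ⟨k₄, h₄, e.le⟩
      · exact ⟨k, hb, e.le⟩
    · rcases hs i hi with rfl | rfl | rfl | rfl | rfl <;> simp

theorem eq_monomial_mul {f p : TropPoly 2} {c : ℝ} {a b : ℤ}
    (h1 : ∀ i j, p.coeff ![i, j] ≠ ⊥ → f.coeff ![a + i, b + j] = (c : WithBot ℝ) + p.coeff ![i, j])
    (h2 : ∀ i j, f.coeff ![i, j] ≠ ⊥ → p.coeff ![i - a, j - b] ≠ ⊥) :
    f = monomial c ![a, b] * p := by
  refine TropPoly.ext (funext fun i => ?_)
  rw [coeff_monomial_mul]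
  have e : i - ![a, b] = ![i 0 - a, i 1 - b] := by
    funext k
    fin_cases k <;> rfl
  rw [e]
  by_cases hp : p.coeff ![i 0 - a, i 1 - b] = ⊥
  · rw [hp, WithBot.add_bot]
    by_contra hf
    exact h2 _ _ (by rwa [vec_eta]) hp
  · rw [← h1 _ _ hp, add_sub_cancel, add_sub_cancel, vec_eta]

variable {f g : TropPoly 2} {a b : ℤ}

theorem coeff_eq_of_realCoeff {i j i' j' : ℤ} {r : ℝ} (h : f.coeff ![i, j] ≠ ⊥)
    (hr : f.realCoeff ![i, j] = r) (hi : i' = i) (hj : j' = j) : f.coeff ![i', j'] = (r : ℝ) := by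
  rw [hi, hj, ← coe_realCoeff h, hr]

theorem Expresses.sameUpToMonomial_first (h : Expresses f g) (hs : FirstSupport f g a b) :
    SameUpToMonomial f₁ g₁ f g := by
  obtain ⟨c01, hc, ef⟩ := evalReal_eq_max_five (f := f) (k := ![a, b + 1]) hs.f10 hs.f11 hs.f00
    hs.f02
    (by
      intro i hi
      rw [← vec_eta i] at hi ⊢
      have := hs.bound_f _ _ hi
      simp only [vec_eq_iff]
      omega)
    (by
      intro t
      simp [pair, Fin.sum_univ_two]
      ring)
  obtain ⟨d11, hd, eg⟩ := evalReal_eq_max_five (f := g) (k := ![a + 1, b + 1]) hs.g01 hs.g02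
    hs.g10 hs.g12
    (by
      intro i hi
      rw [← vec_eta i] at hi ⊢
      have := hs.bound_g _ _ hi
      simp only [vec_eq_iff]
      omega)
    (by
      intro t
      simp [pair, Fin.sum_univ_two]
      ring)
  have key := solve_first (c00 := f.realCoeff ![a, b]) (c10 := f.realCoeff ![a + 1, b])
    (c11 := f.realCoeff ![a + 1, b + 1]) (c02 := f.realCoeff ![a, b + 2]) (c01 := c01)
    (d10 := g.realCoeff ![a + 1, b]) (d01 := g.realCoeff ![a, b + 1])
    (d02 := g.realCoeff ![a, b + 2]) (d12 := g.realCoeff ![a + 1, b + 2]) (d11 := d11) (by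
      intro x y
      have e := h.eval_eq x y
      rw [ef, eg, max_five_comm, max_five_comm'] at e
      simp only [pair_two, Matrix.cons_val_zero, Matrix.cons_val_one] at e
      push_cast at e
      -- Both polynomials are divided by the monomial with exponent (a, b).
      have e' := congrArg (fun r => r - (a * x + b * y)) e
      simp only [add_sub_right_comm _ (phi x y), ← max_sub_sub_right] at e'
      rw [sub_eq_iff_eq_add']
      simp only [← max_add_add_left]
      convert e' using 1
      · ring_nf
      · congr 1
        ring_nf)
  obtain ⟨k1, k2, k3, k4, k5, k6, k7, k8, k9⟩ := key
  -- The average of the end coefficients would be 1/2 below the value just found, so the midpoint is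
  -- a genuine exponent.
  have hc' : f.coeff ![a, b + 1] = c01 := hc.resolve_right (by intro h0; linarith)
  have hd' : g.coeff ![a + 1, b + 1] = d11 := hd.resolve_right (by intro h0; linarith)
  rw [k3] at hc'
  rw [k7] at hd'
  obtain ⟨v1, v2, v3, v4, v5⟩ := coeff_f₁_values
  obtain ⟨w1, w2, w3, w4, w5⟩ := coeff_g₁_values
  refine ⟨f.realCoeff ![a, b], ![a, b], eq_monomial_mul ?_ ?_, eq_monomial_mul ?_ ?_⟩
  · intro i j hij
    rcases coeff_f₁_ne_bot hij with ⟨rfl, rfl⟩ | ⟨rfl, rfl⟩ | ⟨rfl, rfl⟩ | ⟨rfl, rfl⟩ | ⟨rfl, rfl⟩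
    · rw [v1, ← WithBot.coe_add]
      exact coeff_eq_of_realCoeff hs.f11 (by linarith) rfl rfl
    · rw [v2, ← WithBot.coe_add]
      exact coeff_eq_of_realCoeff hs.f02 (by linarith) (by ring) rfl
    · rw [v3, ← WithBot.coe_add]
      exact coeff_eq_of_realCoeff hs.f10 (by linarith) rfl (by ring)
    · rw [v4, ← WithBot.coe_add, add_zero, add_zero, hc']
    · rw [v5, ← WithBot.coe_add]
      exact coeff_eq_of_realCoeff hs.f00 (by linarith) (by ring) (by ring)
  · intro i j hij
    have := hs.bound_f i j hij
    rcases (by omega : (i = a + 1 ∧ j = b + 1) ∨ (i = a ∧ j = b + 2) ∨ (i = a + 1 ∧ j = b) ∨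
      (i = a ∧ j = b + 1) ∨ (i = a ∧ j = b)) with ⟨rfl, rfl⟩ | ⟨rfl, rfl⟩ | ⟨rfl, rfl⟩ |
      ⟨rfl, rfl⟩ | ⟨rfl, rfl⟩ <;> simp [v1, v2, v3, v4, v5]
  · intro i j hij
    rcases coeff_g₁_ne_bot hij with ⟨rfl, rfl⟩ | ⟨rfl, rfl⟩ | ⟨rfl, rfl⟩ | ⟨rfl, rfl⟩ | ⟨rfl, rfl⟩
    · rw [w1, ← WithBot.coe_add]
      exact coeff_eq_of_realCoeff hs.g12 (by linarith) rfl rfl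
    · rw [w2, ← WithBot.coe_add, add_zero, hd']
    · rw [w3, ← WithBot.coe_add]
      exact coeff_eq_of_realCoeff hs.g02 (by linarith) (by ring) rfl
    · rw [w4, ← WithBot.coe_add]
      exact coeff_eq_of_realCoeff hs.g10 (by linarith) rfl (by ring)
    · rw [w5, ← WithBot.coe_add]
      exact coeff_eq_of_realCoeff hs.g01 (by linarith) (by ring) rfl
  · intro i j hij
    have := hs.bound_g i j hij
    rcases (by omega : (i = a + 1 ∧ j = b + 2) ∨ (i = a + 1 ∧ j = b + 1) ∨ (i = a ∧ j = b + 2) ∨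
      (i = a + 1 ∧ j = b) ∨ (i = a ∧ j = b + 1)) with ⟨rfl, rfl⟩ | ⟨rfl, rfl⟩ | ⟨rfl, rfl⟩ |
      ⟨rfl, rfl⟩ | ⟨rfl, rfl⟩ <;> simp [w1, w2, w3, w4, w5]

theorem Expresses.sameUpToMonomial_second (h : Expresses f g) (hs : SecondSupport f g a b) :
    SameUpToMonomial f₂ g₂ f g := by
  obtain ⟨c11, hc, ef⟩ := evalReal_eq_max_five (f := f) (k := ![a + 1, b + 1]) hs.f10 hs.f01
    hs.f20 hs.f02
    (by
      intro i hi
      rw [← vec_eta i] at hi ⊢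
      have := hs.bound_f _ _ hi
      simp only [vec_eq_iff]
      omega)
    (by
      intro t
      simp [pair, Fin.sum_univ_two]
      ring)
  obtain ⟨d11, hd, eg⟩ := evalReal_eq_max_five (f := g) (k := ![a + 1, b + 1]) hs.g21 hs.g12
    hs.g20 hs.g02
    (by
      intro i hi
      rw [← vec_eta i] at hi ⊢
      have := hs.bound_g _ _ hi
      simp only [vec_eq_iff]
      omega)
    (by
      intro t
      simp [pair, Fin.sum_univ_two]
      ring)
  have key := solve_second (c20 := f.realCoeff ![a + 2, b]) (c11 := c11)
    (c02 := f.realCoeff ![a, b + 2]) (c10 := f.realCoeff ![a + 1, b])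
    (c01 := f.realCoeff ![a, b + 1]) (d21 := g.realCoeff ![a + 2, b + 1])
    (d12 := g.realCoeff ![a + 1, b + 2]) (d20 := g.realCoeff ![a + 2, b]) (d11 := d11)
    (d02 := g.realCoeff ![a, b + 2]) (by
      intro x v
      have e := h.eval_eq x (x + v)
      rw [ef, eg, max_five_comm', max_five_comm] at e
      simp only [pair_two, Matrix.cons_val_zero, Matrix.cons_val_one] at e
      push_cast at e
      -- The additional x lowers the degrees of f from 1, 2 to 0, 1, and those of g from 2, 3 to 1,
      -- 2.
      have e' := congrArg (fun r => r - (a * x + b * (x + v) + x)) e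
      simp only [add_sub_right_comm _ (phi x (x + v)), ← max_sub_sub_right] at e'
      rw [sub_eq_iff_eq_add', add_comm (phi x (x + v)), ← add_assoc]
      simp only [← max_add_add_left, ← max_add_add_right] at e' ⊢
      convert e' using 1 <;> ring_nf)
  obtain ⟨k1, k2, k3, k4, k5, k6, k7, k8, k9⟩ := key
  have hc' : f.coeff ![a + 1, b + 1] = c11 := hc.resolve_right (by intro h0; linarith)
  have hd' : g.coeff ![a + 1, b + 1] = d11 := hd.resolve_right (by intro h0; linarith)
  rw [k1] at hc'
  rw [k8] at hd'
  obtain ⟨v1, v2, v3, v4, v5⟩ := coeff_f₂_values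
  obtain ⟨w1, w2, w3, w4, w5⟩ := coeff_g₂_values
  refine ⟨f.realCoeff ![a + 2, b], ![a, b], eq_monomial_mul ?_ ?_, eq_monomial_mul ?_ ?_⟩
  · intro i j hij
    rcases coeff_f₂_ne_bot hij with ⟨rfl, rfl⟩ | ⟨rfl, rfl⟩ | ⟨rfl, rfl⟩ | ⟨rfl, rfl⟩ | ⟨rfl, rfl⟩
    · rw [v1, ← WithBot.coe_add]
      exact coeff_eq_of_realCoeff hs.f20 (by linarith) rfl (by ring)
    · rw [v2, ← WithBot.coe_add, add_zero, hc']
    · rw [v3, ← WithBot.coe_add]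
      exact coeff_eq_of_realCoeff hs.f02 (by linarith) (by ring) rfl
    · rw [v4, ← WithBot.coe_add]
      exact coeff_eq_of_realCoeff hs.f10 (by linarith) rfl (by ring)
    · rw [v5, ← WithBot.coe_add]
      exact coeff_eq_of_realCoeff hs.f01 (by linarith) (by ring) rfl
  · intro i j hij
    have := hs.bound_f i j hij
    rcases (by omega : (i = a + 2 ∧ j = b) ∨ (i = a + 1 ∧ j = b + 1) ∨ (i = a ∧ j = b + 2) ∨
      (i = a + 1 ∧ j = b) ∨ (i = a ∧ j = b + 1)) with ⟨rfl, rfl⟩ | ⟨rfl, rfl⟩ | ⟨rfl, rfl⟩ |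
      ⟨rfl, rfl⟩ | ⟨rfl, rfl⟩ <;> simp [v1, v2, v3, v4, v5]
  · intro i j hij
    rcases coeff_g₂_ne_bot hij with ⟨rfl, rfl⟩ | ⟨rfl, rfl⟩ | ⟨rfl, rfl⟩ | ⟨rfl, rfl⟩ | ⟨rfl, rfl⟩
    · rw [w1, ← WithBot.coe_add]
      exact coeff_eq_of_realCoeff hs.g21 (by linarith) rfl rfl
    · rw [w2, ← WithBot.coe_add]
      exact coeff_eq_of_realCoeff hs.g12 (by linarith) rfl rfl
    · rw [w3, ← WithBot.coe_add]
      exact coeff_eq_of_realCoeff hs.g20 (by linarith) rfl (by ring)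
    · rw [w4, ← WithBot.coe_add, add_zero, hd']
    · rw [w5, ← WithBot.coe_add]
      exact coeff_eq_of_realCoeff hs.g02 (by linarith) (by ring) rfl
  · intro i j hij
    have := hs.bound_g i j hij
    rcases (by omega : (i = a + 2 ∧ j = b + 1) ∨ (i = a + 1 ∧ j = b + 2) ∨ (i = a + 2 ∧ j = b) ∨
      (i = a + 1 ∧ j = b + 1) ∨ (i = a ∧ j = b + 2)) with ⟨rfl, rfl⟩ | ⟨rfl, rfl⟩ | ⟨rfl, rfl⟩ |
      ⟨rfl, rfl⟩ | ⟨rfl, rfl⟩ <;> simp [w1, w2, w3, w4, w5]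

end Identification

/-! ### Assembly: the dichotomy for expressions and the minimum -/

section Main

variable {f g : TropPoly 2}

theorem vec_eta_real (t : Fin 2 → ℝ) : ![t 0, t 1] = t := by
  funext k
  fin_cases k <;> rfl

theorem isExpression_iff_expresses : IsExpression (quot f₁ g₁) f g ↔ Expresses f g := by
  rw [isExpression_quot_iff f₁_ne_bot]
  constructor
  · rintro ⟨hf, hg, h⟩
    refine ⟨hf, hg, fun x y => ?_⟩
    rw [← evalReal_f₁_sub_g₁, ← h]
    ring
  · rintro ⟨hf, hg, h⟩
    refine ⟨hf, hg, fun t => ?_⟩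
    rw [← vec_eta_real t, h, evalReal_f₁_sub_g₁]
    ring

theorem expresses_f₁_g₁ : Expresses f₁ g₁ :=
  ⟨f₁_ne_bot, g₁_ne_bot, fun x y => by rw [← evalReal_f₁_sub_g₁]; ring⟩

theorem expresses_f₂_g₂ : Expresses f₂ g₂ :=
  ⟨f₂_ne_bot, g₂_ne_bot, fun x y => by rw [← evalReal_f₂_sub_g₂]; ring⟩

theorem Expresses.monomial_mul (h : Expresses f g) (c : ℝ) (k : Fin 2 → ℤ) :
    Expresses (monomial c k * f) (monomial c k * g) := by
  refine ⟨monomial_mul_ne_bot h.left_ne c k, monomial_mul_ne_bot h.right_ne c k, fun x y => ?_⟩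
  rw [evalReal_monomial_mul c k h.left_ne, evalReal_monomial_mul c k h.right_ne, h.eval_eq]
  ring

theorem Expresses.sameUpToMonomial_or_le_vol (h : Expresses f g) :
    SameUpToMonomial f₁ g₁ f g ∨ SameUpToMonomial f₂ g₂ f g ∨ 11 / 6 ≤ vol f g := by
  by_cases hv : 11 / 6 ≤ vol f g
  · exact Or.inr (Or.inr hv)
  · rcases h.small_cases (not_le.1 hv) with ⟨_, _, _, _, _, hs⟩ | ⟨a, b, hs⟩ | ⟨a, b, hs⟩
    · exact (h.not_two_rows hs).elim
    · exact Or.inl (h.sameUpToMonomial_first hs)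
    · exact Or.inr (Or.inl (h.sameUpToMonomial_second hs))

theorem SameUpToMonomial.vol_eq {p q : TropPoly 2} (h : SameUpToMonomial p q f g) :
    vol f g = vol p q := by
  obtain ⟨c, k, rfl, rfl⟩ := h
  exact vol_monomial_mul c k p q

theorem Expresses.five_thirds_le_vol (h : Expresses f g) : 5 / 3 ≤ vol f g := by
  rcases h.sameUpToMonomial_or_le_vol with hs | hs | hv
  · rw [hs.vol_eq, vol_f₁_g₁]
  · rw [hs.vol_eq, vol_f₂_g₂]
  · linarith

theorem Expresses.isMinVolExpression (h : Expresses f g) (hv : vol f g = 5 / 3) :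
    IsMinVolExpression (quot f₁ g₁) f g :=
  ⟨isExpression_iff_expresses.2 h, fun f' g' h' => by
    rw [hv]
    exact (isExpression_iff_expresses.1 h').five_thirds_le_vol⟩

end Main

end TropPoly

theorem mainTheorem2 :
    ∃ φ : (Fin 2 → ℝ) → WithBot ℝ,
      -- the two explicit pairs are minimum volume expressions of `φ`, of volume `5/3`
      TropPoly.IsMinVolExpression φ TropPoly.f₁ TropPoly.g₁ ∧
      TropPoly.IsMinVolExpression φ TropPoly.f₂ TropPoly.g₂ ∧
      TropPoly.vol TropPoly.f₁ TropPoly.g₁ = 5 / 3 ∧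
      TropPoly.vol TropPoly.f₂ TropPoly.g₂ = 5 / 3 ∧
      -- they are different: neither do they differ by a common monomial, nor are the Newton
      -- polytopes of `f₁ ⊕ (z ⊙ g₁)` and `f₂ ⊕ (z ⊙ g₂)` translates of each other
      ¬ TropPoly.SameUpToMonomial TropPoly.f₁ TropPoly.g₁ TropPoly.f₂ TropPoly.g₂ ∧
      (∀ v : Fin 3 → ℝ,
        (TropPoly.graphPoly TropPoly.f₂ TropPoly.g₂).newt ≠
          (fun p => v + p) '' (TropPoly.graphPoly TropPoly.f₁ TropPoly.g₁).newt) ∧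
      -- up to a common monomial there are no other minimum volume expressions
      (∀ f g : TropPoly 2, TropPoly.IsMinVolExpression φ f g ↔
        TropPoly.SameUpToMonomial TropPoly.f₁ TropPoly.g₁ f g ∨
          TropPoly.SameUpToMonomial TropPoly.f₂ TropPoly.g₂ f g) ∧
      -- every other expression has volume at least `11/6`
      (∀ f g : TropPoly 2, TropPoly.IsExpression φ f g →
        ¬ TropPoly.SameUpToMonomial TropPoly.f₁ TropPoly.g₁ f g →
        ¬ TropPoly.SameUpToMonomial TropPoly.f₂ TropPoly.g₂ f g →
        11 / 6 ≤ TropPoly.vol f g) := by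
  open TropPoly in
  refine ⟨quot f₁ g₁, expresses_f₁_g₁.isMinVolExpression vol_f₁_g₁,
    expresses_f₂_g₂.isMinVolExpression vol_f₂_g₂, vol_f₁_g₁, vol_f₂_g₂, not_sameUpToMonomial,
    newt_f₂_g₂_ne_translate, fun f g => ⟨fun h => ?_, ?_⟩, fun f g h h1 h2 => ?_⟩
  · rcases (isExpression_iff_expresses.1 h.1).sameUpToMonomial_or_le_vol with hs | hs | hv
    · exact Or.inl hs
    · exact Or.inr hs
    · have := h.2 _ _ (isExpression_iff_expresses.2 expresses_f₁_g₁)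
      rw [vol_f₁_g₁] at this
      linarith
  · rintro (hs | hs)
    · obtain ⟨c, k, rfl, rfl⟩ := id hs
      exact (expresses_f₁_g₁.monomial_mul c k).isMinVolExpression (hs.vol_eq.trans vol_f₁_g₁)
    · obtain ⟨c, k, rfl, rfl⟩ := id hs
      exact (expresses_f₂_g₂.monomial_mul c k).isMinVolExpression (hs.vol_eq.trans vol_f₂_g₂)
  · rcases (isExpression_iff_expresses.1 h).sameUpToMonomial_or_le_vol with hs | hs | hv
    · exact absurd hs h1
    · exact absurd hs h2
    · exact hv
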